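/- Let $K$ be a field and let $G$ be a finite connected simple graph with vertex set $[n]=\{1,\dots,n\}$. Let $J_G\subseteq S=K[x_1,\dots,x_n,y_1,\dots,y_n]$ be its binomial edge ideal, generated by the binomials $x_iy_j-x_jy_i$ with $i<j$ and $\{i,j\}\in E(G)$; it is called unmixed if all associated primes of $S/J_G$ have the same height. Suppose that $G$ is a generalized block graph, i.e. $G$ is chordal and whenever three distinct maximal cliques $F_1,F_2,F_3$ of $G$ satisfy $F_1\cap F_2\cap F_3\neq\emptyset$, then $F_1\cap F_2=F_1\cap F_3=F_2\cap F_3$ (a clique is identified with its vertex set). A cut set of $G$ is a set of vertices whose deletion increases the number of connected components, and a minimal cut set is a cut set that is minimal under inclusion. A minimal cut set $A$ is called a $t$-minimal cut set if there are $t$ distinct maximal cliques $F_1,\dots,F_t$ of $G$ with $\bigcap_{j=1}^t F_j=A$ such that every other maximal clique of $G$ is disjoint from $A$. Then $J_G$ is unmixed if and only if the following two conditions hold: (a) for every $t$ and every $t$-minimal cut set $A$ of $G$, $|A|=t-1$; (b) whenever $A_1,\dots,A_s$ are minimal cut sets of $G$ whose union $A_1\cup\dots\cup A_s$ is a maximal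 clique of $G$, then $|A_i|=1$ for some $i\in\{1,\dots,s\}$. -/

import Mathlib

namespace GenBlock

/-- A maximal clique of `G`, that is, a facet of the clique complex of `G`. -/
def IsMaxClique {V : Type*} (G : SimpleGraph V) (F : Finset V) : Prop :=
  Maximal (fun s : Finset V => G.IsClique (s : Set V)) F

/-- Every cycle of length at least `4` has a chord. -/
def IsChordal {V : Type*} (G : SimpleGraph V) : Prop :=
  ∀ (v : V) (c : G.Walk v v), c.IsCycle → 4 ≤ c.length →
    ∃ a ∈ c.support, ∃ b ∈ c.support, G.Adj a b ∧ s(a, b) ∉ c.edges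

/-- A chordal graph in which any three (distinct) maximal cliques with a common vertex have
equal pairwise intersections. Connectedness is assumed separately. -/
def IsGeneralizedBlockGraph {V : Type*} [DecidableEq V] (G : SimpleGraph V) : Prop :=
  IsChordal G ∧
    ∀ F₁ F₂ F₃ : Finset V, IsMaxClique G F₁ → IsMaxClique G F₂ → IsMaxClique G F₃ →
      F₁ ≠ F₂ → F₁ ≠ F₃ → F₂ ≠ F₃ → (F₁ ∩ F₂ ∩ F₃).Nonempty →
        F₁ ∩ F₂ = F₁ ∩ F₃ ∧ F₁ ∩ F₃ = F₂ ∩ F₃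

/-- A set of vertices whose deletion increases the number of connected components. -/
def IsCutSet {V : Type*} (G : SimpleGraph V) (A : Finset V) : Prop :=
  Nat.card G.ConnectedComponent < Nat.card (G.induce ((A : Set V)ᶜ)).ConnectedComponent

/-- A cut set that is minimal under inclusion. -/
def IsMinimalCutSet {V : Type*} (G : SimpleGraph V) (A : Finset V) : Prop :=
  Minimal (IsCutSet G) A

/-- A minimal cut set `A` that is the intersection of `t` maximal cliques, all other maximal
cliques being disjoint from `A`. -/
def IsTMinimalCutSet {V : Type*} [Fintype V] [DecidableEq V] (G : SimpleGraph V) (t : ℕ)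
    (A : Finset V) : Prop :=
  IsMinimalCutSet G A ∧
    ∃ 𝓕 : Finset (Finset V), 𝓕.card = t ∧ (∀ F ∈ 𝓕, IsMaxClique G F) ∧ 𝓕.inf id = A ∧
      ∀ F : Finset V, IsMaxClique G F → F ∉ 𝓕 → Disjoint F A

/-- The binomial edge ideal, generated by `x_i y_j - x_j y_i` for the edges `{i, j}`, in the
polynomial ring with variables `x_i = X (Sum.inl i)` and `y_i = X (Sum.inr i)`. Both
orientations of an edge are used; they give generators that differ by a sign. -/
noncomputable def binomialEdgeIdeal (K : Type*) [Field K] {V : Type*} (G : SimpleGraph V) :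
    Ideal (MvPolynomial (V ⊕ V) K) :=
  Ideal.span {f | ∃ i j : V, G.Adj i j ∧
    f = MvPolynomial.X (Sum.inl i) * MvPolynomial.X (Sum.inr j) -
      MvPolynomial.X (Sum.inl j) * MvPolynomial.X (Sum.inr i)}

/-- An ideal `I` is unmixed if all associated primes of `R / I` have the same height, the height
of `I`. -/
def IsUnmixed {R : Type*} [CommRing R] (I : Ideal R) : Prop :=
  ∀ P ∈ associatedPrimes R (R ⧸ I), P.height = I.height

end GenBlock

/-!
The minimal primes of `J_G` are found by repeatedly applying
`J_G = J_{G_v} ∩ ((x_v, y_v) + J_G)`, where `G_v` is `G` with the neighbourhood of `v` completed: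
this ends in the ideals `P_S(G)` generated by the variables at the vertices of `S` and by all
minors of pairs of vertices connected in `G - S`. Each `P_S(G)` is the kernel of a toric
parametrization, hence a prime, and explicit chains of primes give it height
`n + |S| - c(S)`, where `c(S)` is the number of components of `G - S`. It is minimal exactly when
putting back any vertex of `S` joins components, so for connected `G` unmixedness says that
`c(S) = |S| + 1` for all such `S`.

In a generalized block graph the minimal cut sets are the intersections of two maximal cliques
that meet. Distinct ones are disjoint, and every maximal clique meeting one of them contains it;
so deleting a minimal cut set that lies in `t` maximal cliques adds `t - 1` components, except that
a maximal clique that has been deleted entirely contributes no component. Every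
set with the cut property is a union of minimal cut sets, and conditions (a) and (b) say that each
of these lies in the right number of cliques and that no maximal clique is deleted entirely.
-/

namespace GenBlock

section AssociatedPrimes

variable {R : Type*} [CommRing R]

theorem exists_le_of_iInf_le {ι : Type*} [Finite ι] {I : ι → Ideal R} {P : Ideal R}
    (hP : P.IsPrime) (h : ⨅ i, I i ≤ P) : ∃ i, I i ≤ P := by
  cases nonempty_fintype ι
  rw [← Finset.inf_univ_eq_iInf, hP.inf_le'] at h
  simpa using h

variable [IsNoetherianRing R]

theorem mem_associatedPrimes_quotient_iInf_iff {ι : Type*} [Finite ι] {P : ι → Ideal R}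
    (hP : ∀ i, (P i).IsPrime) {Q : Ideal R} :
    Q ∈ associatedPrimes R (R ⧸ ⨅ i, P i) ↔ Minimal (· ∈ Set.range P) Q := by
  constructor
  · intro hQ
    obtain ⟨hprime, x, hx⟩ := isAssociatedPrime_iff.1 hQ
    obtain ⟨f, rfl⟩ := Ideal.Quotient.mk_surjective x
    have hcolon : Q = ⨅ i, (P i).colon {f} := by
      ext g
      rw [hx, Submodule.mem_colon_singleton, Submodule.mem_bot, Algebra.smul_def,
        Ideal.Quotient.algebraMap_eq, ← map_mul, Ideal.Quotient.eq_zero_iff_mem]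
      simp [Submodule.mem_colon_singleton]
    have hle {i : ι} (hi : f ∉ P i) : Q ≤ P i := fun g hg =>
      ((hP i).mem_or_mem (Submodule.mem_colon_singleton.1
        (Ideal.mem_iInf.1 (hcolon ▸ hg) i))).resolve_right hi
    obtain ⟨i, hi⟩ := exists_le_of_iInf_le hprime hcolon.ge
    have hfi : f ∉ P i := fun hf => hprime.one_notMem
      (hi (Submodule.mem_colon_singleton.2 (by simpa using hf)))
    have hPQ : P i ≤ Q := fun g hg =>
      hi (Submodule.mem_colon_singleton.2 (Ideal.mul_mem_right f _ hg))
    refine ⟨⟨i, hPQ.antisymm (hle hfi)⟩, ?_⟩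
    rintro _ ⟨j, rfl⟩ hj
    exact hle fun hfj => hfi (hle hfi (hj hfj))
  · rintro ⟨⟨i, rfl⟩, hi⟩
    apply Module.associatedPrimes.minimalPrimes_annihilator_subset_associatedPrimes
    rw [Ideal.annihilator_quotient]
    refine ⟨⟨hP i, iInf_le P i⟩, fun J ⟨hJ, hle⟩ hJi => ?_⟩
    obtain ⟨j, hj⟩ := exists_le_of_iInf_le hJ hle
    exact (hi ⟨j, rfl⟩ (hj.trans hJi)).trans hj

theorem isUnmixed_iff_of_mem_associatedPrimes {I Q : Ideal R}
    (hQ : Q ∈ associatedPrimes R (R ⧸ I)) :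
    IsUnmixed I ↔ ∀ P ∈ associatedPrimes R (R ⧸ I), P.height = Q.height := by
  refine ⟨fun h P hP => (h P hP).trans (h Q hQ).symm, fun h P hP => ?_⟩
  have hIQ : I ≤ Q := by
    simpa only [Submodule.annihilator_top, Ideal.annihilator_quotient] using
      IsAssociatedPrime.annihilator_le hQ
  have hmin {J : Ideal R} (hJ : J ∈ I.minimalPrimes) : J ∈ associatedPrimes R (R ⧸ I) := by
    apply Module.associatedPrimes.minimalPrimes_annihilator_subset_associatedPrimes
    rwa [Ideal.annihilator_quotient]
  rw [h P hP]
  refine le_antisymm ?_ (Ideal.height_mono hIQ)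
  rw [Ideal.height_eq_inf_minimalPrimes I]
  exact le_iInf₂ fun J hJ => (h J (hmin hJ)).ge

end AssociatedPrimes

open MvPolynomial

section KillVars

variable {R : Type*} [CommRing R] {σ : Type*}

/-- The retraction of a polynomial ring that sends the variables in `W` to zero. -/
noncomputable def killVars (R : Type*) [CommRing R] (W : Set σ) :
    MvPolynomial σ R →ₐ[R] MvPolynomial σ R :=
  aeval (Wᶜ.indicator X)

theorem killVars_X_of_mem {W : Set σ} {s : σ} (hs : s ∈ W) : killVars R W (X s) = 0 := by
  simp [killVars, hs]

theorem killVars_X_of_notMem {W : Set σ} {s : σ} (hs : s ∉ W) : killVars R W (X s) = X s := by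
  simp [killVars, hs]

theorem sub_killVars_mem {I : Ideal (MvPolynomial σ R)} {W : Set σ} (h : ∀ s ∈ W, X s ∈ I)
    (p : MvPolynomial σ R) : p - killVars R W p ∈ I := by
  have heq : Ideal.Quotient.mkₐ R I = (Ideal.Quotient.mkₐ R I).comp (killVars R W) := by
    refine MvPolynomial.algHom_ext fun s => Ideal.Quotient.eq.2 ?_
    by_cases hs : s ∈ W
    · simpa [killVars_X_of_mem hs] using h s hs
    · simp [killVars_X_of_notMem hs]
  exact Ideal.Quotient.eq.1 (DFunLike.congr_fun heq p)

theorem sub_killVars_mem_of_mem_span {I : Ideal (MvPolynomial σ R)} {W : Set σ}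
    {s : Set (MvPolynomial σ R)} (hfix : ∀ g ∈ s, killVars R W g = g)
    (hmul : ∀ g ∈ s, ∀ w ∈ W, X w * g ∈ I) {m : MvPolynomial σ R} (hm : m ∈ Ideal.span s) :
    m - killVars R W m ∈ I := by
  induction hm using Submodule.closure_induction with
  | zero => simp
  | add f g _ _ hf hg => simpa [add_sub_add_comm] using add_mem hf hg
  | smul_mem a g hg =>
    have hcolon : a - killVars R W a ∈ I.colon {g} := sub_killVars_mem
      (fun w hw => Submodule.mem_colon_singleton.2 (hmul g hg w hw)) a
    simpa [hfix g hg, sub_mul] using Submodule.mem_colon_singleton.1 hcolon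

end KillVars

section RelIdeal

variable {R : Type*} [CommRing R] {V : Type*} {r r' : V → V → Prop} {T T' : Set V}

/-- The variables `x_v` and `y_v` with `v ∈ T`. -/
def cols (T : Set V) : Set (V ⊕ V) := Sum.elim id id ⁻¹' T

@[simp] theorem inl_mem_cols {v : V} : Sum.inl v ∈ cols T ↔ v ∈ T := Iff.rfl

@[simp] theorem inr_mem_cols {v : V} : Sum.inr v ∈ cols T ↔ v ∈ T := Iff.rfl

/-- The minor `x_i y_j - x_j y_i` of the generic `2 × V` matrix. -/
noncomputable def minor (R : Type*) [CommRing R] (i j : V) : MvPolynomial (V ⊕ V) R :=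
  X (Sum.inl i) * X (Sum.inr j) - X (Sum.inl j) * X (Sum.inr i)

@[simp] theorem minor_self (i : V) : minor R i i = 0 := sub_self _

/-- The ideal generated by both variables at each vertex of `T` and by the minors of the pairs
related by `r`. -/
noncomputable def relIdeal (R : Type*) [CommRing R] (r : V → V → Prop) (T : Set V) :
    Ideal (MvPolynomial (V ⊕ V) R) :=
  Ideal.span (X '' cols T) ⊔ Ideal.span {f | ∃ i j, r i j ∧ f = minor R i j}

theorem relIdeal_le_iff {I : Ideal (MvPolynomial (V ⊕ V) R)} :
    relIdeal R r T ≤ I ↔ (∀ s ∈ cols T, X s ∈ I) ∧ ∀ i j, r i j → minor R i j ∈ I := by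
  simp only [relIdeal, sup_le_iff, Ideal.span_le, Set.image_subset_iff]
  refine and_congr Iff.rfl ⟨fun h i j hij => h ⟨i, j, hij, rfl⟩, ?_⟩
  rintro h _ ⟨i, j, hij, rfl⟩
  exact h i j hij

theorem X_mem_relIdeal {s : V ⊕ V} (hs : s ∈ cols T) : X s ∈ relIdeal R r T :=
  (relIdeal_le_iff.1 le_rfl).1 s hs

theorem minor_mem_relIdeal {i j : V} (h : r i j) : minor R i j ∈ relIdeal R r T :=
  (relIdeal_le_iff.1 le_rfl).2 i j h

theorem minor_mem_relIdeal_of_mem {i j : V} (h : i ∈ T ∨ j ∈ T) : minor R i j ∈ relIdeal R r T := by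
  rcases h with h | h
  · exact sub_mem (Ideal.mul_mem_right _ _ (X_mem_relIdeal (inl_mem_cols.2 h)))
      (Ideal.mul_mem_left _ _ (X_mem_relIdeal (inr_mem_cols.2 h)))
  · exact sub_mem (Ideal.mul_mem_left _ _ (X_mem_relIdeal (inr_mem_cols.2 h)))
      (Ideal.mul_mem_right _ _ (X_mem_relIdeal (inl_mem_cols.2 h)))

theorem relIdeal_mono (hT : T ⊆ T')
    (h : ∀ i j, i ∉ T' → j ∉ T' → r i j → i = j ∨ r' i j) : relIdeal R r T ≤ relIdeal R r' T' := by
  refine relIdeal_le_iff.2 ⟨fun s hs => X_mem_relIdeal (Set.preimage_mono hT hs), fun i j hij => ?_⟩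
  by_cases hmem : i ∈ T' ∨ j ∈ T'
  · exact minor_mem_relIdeal_of_mem hmem
  push Not at hmem
  rcases h i j hmem.1 hmem.2 hij with rfl | hij'
  · simp
  · exact minor_mem_relIdeal hij'

theorem eval_eq_zero_of_mem_relIdeal {p q : V → R} (hp : ∀ v ∈ T, p v = 0) (hq : ∀ v ∈ T, q v = 0)
    (h : ∀ i j, r i j → p i * q j = p j * q i) {f : MvPolynomial (V ⊕ V) R}
    (hf : f ∈ relIdeal R r T) : eval (Sum.elim p q) f = 0 := by
  suffices hle : relIdeal R r T ≤ RingHom.ker (eval (Sum.elim p q)) from hle hf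
  refine relIdeal_le_iff.2 ⟨?_, fun i j hij => ?_⟩
  · rintro (v | v) hv
    · simpa using hp v hv
    · simpa using hq v hv
  · simp [RingHom.mem_ker, minor, h i j hij]

theorem X_mem_relIdeal_iff [Nontrivial R] {s : V ⊕ V} : X s ∈ relIdeal R r T ↔ s ∈ cols T := by
  refine ⟨fun h => ?_, X_mem_relIdeal⟩
  have heval := eval_eq_zero_of_mem_relIdeal (p := Tᶜ.indicator 1) (q := Tᶜ.indicator 1)
    (by simp +contextual) (by simp +contextual) (fun i j _ => mul_comm _ _) h
  rcases s with v | v <;> simpa using heval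

theorem rel_of_minor_mem_relIdeal [Nontrivial R] (hr : Equivalence r) {i j : V} (hi : i ∉ T)
    (hj : j ∉ T) (h : minor R i j ∈ relIdeal R r T) : r i j := by
  classical
  by_contra hij
  have heval := eval_eq_zero_of_mem_relIdeal (p := fun k => if k ∉ T ∧ r i k then (1 : R) else 0)
    (q := fun k => if k ∉ T ∧ ¬ r i k then 1 else 0) (by simp +contextual) (by simp +contextual)
    (fun a b hab => by
      have hiff : r i a ↔ r i b := ⟨(hr.trans · hab), (hr.trans · (hr.symm hab))⟩
      by_cases hb : r i b <;> simp [hiff, hb]) h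
  simp [minor, hi, hj, hij, hr.refl i] at heval

theorem killVars_cols_minor_of_mem {i j : V} (h : i ∈ T ∨ j ∈ T) :
    killVars R (cols T) (minor R i j) = 0 := by
  rcases h with h | h <;>
  simp [minor, killVars_X_of_mem (inl_mem_cols.2 h), killVars_X_of_mem (inr_mem_cols.2 h)]

theorem killVars_cols_minor_of_notMem {i j : V} (hi : i ∉ T) (hj : j ∉ T) :
    killVars R (cols T) (minor R i j) = minor R i j := by
  simp [minor, killVars_X_of_notMem, hi, hj]

theorem killVars_mem_relIdeal {p : MvPolynomial (V ⊕ V) R} (hp : p ∈ relIdeal R r (T' ∪ T)) :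
    killVars R (cols T') p ∈ relIdeal R r T := by
  suffices hle : relIdeal R r (T' ∪ T) ≤ (relIdeal R r T).comap (killVars R (cols T')) from hle hp
  refine relIdeal_le_iff.2 ⟨fun s hs => Ideal.mem_comap.2 ?_, fun i j hij => Ideal.mem_comap.2 ?_⟩
  · by_cases hs' : s ∈ cols T'
    · simp [killVars_X_of_mem hs']
    · rw [killVars_X_of_notMem hs']
      exact X_mem_relIdeal (hs.resolve_left hs')
  · by_cases hmem : i ∈ T' ∨ j ∈ T'
    · simp [killVars_cols_minor_of_mem hmem]
    · push Not at hmem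
      rw [killVars_cols_minor_of_notMem hmem.1 hmem.2]
      exact minor_mem_relIdeal hij

end RelIdeal

section Decomposition

variable {R : Type*} [CommRing R] {V : Type*} {G H : SimpleGraph V} {S T : Set V}

/-- The graph `G` with the neighbourhood of `v` completed to a clique. -/
def completeNbhd (G : SimpleGraph V) (v : V) : SimpleGraph V where
  Adj a b := a ≠ b ∧ (G.Adj a b ∨ G.Adj v a ∧ G.Adj v b)
  symm := ⟨fun _ _ h => ⟨h.1.symm, h.2.imp G.adj_symm And.symm⟩⟩
  loopless := ⟨fun _ h => h.1 rfl⟩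

theorem le_completeNbhd (G : SimpleGraph V) (v : V) : G ≤ completeNbhd G v :=
  fun _ _ h => ⟨h.ne, Or.inl h⟩

theorem relIdeal_completeNbhd_le (G : SimpleGraph V) (v : V) (T : Set V) :
    relIdeal R (completeNbhd G v).Adj T ≤ relIdeal R G.Adj T ⊔
      Ideal.span {f | ∃ i j, (G.Adj v i ∧ G.Adj v j) ∧ f = minor R i j} := by
  refine relIdeal_le_iff.2 ⟨fun s hs => Ideal.mem_sup_left (X_mem_relIdeal hs), ?_⟩
  rintro i j ⟨-, hij | hij⟩
  · exact Ideal.mem_sup_left (minor_mem_relIdeal hij)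
  · exact Ideal.mem_sup_right (Ideal.subset_span ⟨i, j, hij, rfl⟩)

theorem X_mul_minor_mem_relIdeal {r : V → V → Prop} {v a b : V} (ha : r v a) (hb : r v b)
    {s : V ⊕ V} (hs : s ∈ cols {v}) : X s * minor R a b ∈ relIdeal R r T := by
  have hplucker : ∃ f g : MvPolynomial (V ⊕ V) R,
      X s * minor R a b = f * minor R v b - g * minor R v a := by
    rcases s with w | w
    · obtain rfl : w = v := hs
      exact ⟨X (Sum.inl a), X (Sum.inl b), by simp only [minor]; ring⟩
    · obtain rfl : w = v := hs
      exact ⟨X (Sum.inr a), X (Sum.inr b), by simp only [minor]; ring⟩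
  obtain ⟨f, g, hfg⟩ := hplucker
  rw [hfg]
  exact sub_mem (Ideal.mul_mem_left _ _ (minor_mem_relIdeal hb))
    (Ideal.mul_mem_left _ _ (minor_mem_relIdeal ha))

theorem relIdeal_completeNbhd_inf_le (G : SimpleGraph V) (v : V) (T : Set V) :
    relIdeal R (completeNbhd G v).Adj T ⊓ relIdeal R G.Adj (insert v T) ≤ relIdeal R G.Adj T := by
  rintro f ⟨hf, hfv⟩
  obtain ⟨g, hg, m, hm, rfl⟩ := Submodule.mem_sup.1 (relIdeal_completeNbhd_le G v T hf)
  rw [SetLike.mem_coe, Set.insert_eq] at hfv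
  have hkill : killVars R (cols {v}) m ∈ relIdeal R G.Adj T := by
    have hkg : killVars R (cols {v}) g ∈ relIdeal R G.Adj T :=
      killVars_mem_relIdeal (relIdeal_mono Set.subset_union_right (fun _ _ _ _ => Or.inr) hg)
    simpa using sub_mem (killVars_mem_relIdeal hfv) hkg
  have hsub : m - killVars R (cols {v}) m ∈ relIdeal R G.Adj T := by
    refine sub_killVars_mem_of_mem_span ?_ ?_ hm
    · rintro _ ⟨i, j, ⟨hi, hj⟩, rfl⟩
      exact killVars_cols_minor_of_notMem hi.ne' hj.ne'
    · rintro _ ⟨i, j, ⟨hi, hj⟩, rfl⟩ s hs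
      exact X_mul_minor_mem_relIdeal hi hj hs
  exact add_mem hg (by simpa using add_mem hsub hkill)

/-- The graph `G` with all edges at the vertices of `S` deleted. The vertices of `S` stay, as
isolated vertices. -/
def deleteVerts (G : SimpleGraph V) (S : Set V) : SimpleGraph V where
  Adj a b := G.Adj a b ∧ a ∉ S ∧ b ∉ S
  symm := ⟨fun _ _ h => ⟨h.1.symm, h.2.2, h.2.1⟩⟩
  loopless := ⟨fun _ h => h.1.ne rfl⟩

theorem deleteVerts_mono (h : G ≤ H) (hTS : T ⊆ S) : deleteVerts G S ≤ deleteVerts H T :=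
  fun _ _ hab => ⟨h hab.1, fun ha => hab.2.1 (hTS ha), fun hb => hab.2.2 (hTS hb)⟩

/-- The ideal `P_S(G)`, generated by the variables at the vertices of `S` and the minors of the
pairs of vertices that are connected in `G - S`. -/
noncomputable def componentIdeal (R : Type*) [CommRing R] (G : SimpleGraph V) (S : Set V) :
    Ideal (MvPolynomial (V ⊕ V) R) :=
  relIdeal R (deleteVerts G S).Reachable S

theorem componentIdeal_mono (h : G ≤ H) : componentIdeal R G S ≤ componentIdeal R H S :=
  relIdeal_mono subset_rfl fun _ _ _ _ hij => Or.inr (hij.mono (deleteVerts_mono h subset_rfl))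

theorem relIdeal_le_componentIdeal (h : T ⊆ S) : relIdeal R G.Adj T ≤ componentIdeal R G S :=
  relIdeal_mono h fun _ _ hi hj hij => Or.inr
    (SimpleGraph.Adj.reachable (G := deleteVerts G S) ⟨hij, hi, hj⟩)

theorem eq_or_adj_of_reachable_deleteVerts
    (h : ∀ v ∉ T, ∀ a b, a ≠ b → G.Adj v a → G.Adj v b → G.Adj a b) {a b : V}
    (hab : (deleteVerts G T).Reachable a b) : a = b ∨ G.Adj a b := by
  obtain ⟨p⟩ := hab
  induction p with
  | nil => exact Or.inl rfl
  | @cons a c b hac p ih =>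
    obtain ⟨hac, -, hc⟩ := hac
    rcases ih with rfl | hcb
    · exact Or.inr hac
    · exact or_iff_not_imp_left.2 fun hne => h c hc a b hne hac.symm hcb

theorem iInf_componentIdeal_le [Finite V] (G : SimpleGraph V) (T : Set V) :
    ⨅ S, ⨅ (_ : T ⊆ S), componentIdeal R G S ≤ relIdeal R G.Adj T := by
  obtain ⟨p, hp⟩ : ∃ p : SimpleGraph V × Set V, p = (G, T) := ⟨_, rfl⟩
  induction p using WellFoundedGT.induction generalizing G T with
  | ind p ih =>
  subst hp
  by_cases h : ∀ v ∉ T, ∀ a b, a ≠ b → G.Adj v a → G.Adj v b → G.Adj a b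
  · exact (iInf₂_le T subset_rfl).trans
      (relIdeal_mono subset_rfl fun _ _ _ _ => eq_or_adj_of_reachable_deleteVerts h)
  push Not at h
  obtain ⟨v, hv, a, b, hne, ha, hb, hab⟩ := h
  have hG : G < completeNbhd G v := lt_of_le_not_ge (le_completeNbhd G v) fun hle =>
    hab (hle ⟨hne, Or.inr ⟨ha, hb⟩⟩)
  refine (le_inf ?_ ?_).trans (relIdeal_completeNbhd_inf_le G v T)
  · exact (iInf₂_mono fun S _ => componentIdeal_mono (le_completeNbhd G v)).trans
      (ih _ (Prod.mk_lt_mk_iff_left.2 hG) _ T rfl)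
  · exact (le_iInf₂ fun S hS => iInf₂_le S ((Set.subset_insert v T).trans hS)).trans
      (ih _ (Prod.mk_lt_mk_iff_right.2 (Set.ssubset_insert hv)) G _ rfl)

theorem binomialEdgeIdeal_eq_relIdeal (K : Type*) [Field K] (G : SimpleGraph V) :
    binomialEdgeIdeal K G = relIdeal K G.Adj ∅ := by
  simp [binomialEdgeIdeal, relIdeal, cols, minor]

theorem binomialEdgeIdeal_eq_iInf [Finite V] (K : Type*) [Field K] (G : SimpleGraph V) :
    binomialEdgeIdeal K G = ⨅ S, componentIdeal K G S := by
  rw [binomialEdgeIdeal_eq_relIdeal]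
  refine le_antisymm (le_iInf fun S => relIdeal_le_componentIdeal (Set.empty_subset S)) ?_
  simpa using iInf_componentIdeal_le (R := K) G ∅

end Decomposition

section Toric

variable {R : Type*} [CommRing R] {V ι : Type*} {c : V → ι} {a b : V ⊕ V →₀ ℕ} {T : Set V}

theorem mem_of_map_monomial_eq_monomial {σ τ : Type*} {φ : MvPolynomial σ R →ₗ[R] MvPolynomial τ R}
    {D : (σ →₀ ℕ) → (τ →₀ ℕ)} (hφ : ∀ a, φ (monomial a 1) = monomial (D a) 1)
    {I : Ideal (MvPolynomial σ R)}
    (hI : ∀ a b, D a = D b → monomial a (1 : R) - monomial b 1 ∈ I)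
    {p : MvPolynomial σ R} (hp : φ p = 0) : p ∈ I := by
  let ψ : MvPolynomial τ R →ₗ[R] MvPolynomial σ R ⧸ I := (basisMonomials τ R).constr R
    fun d => Ideal.Quotient.mk I (monomial (Function.invFun D d) 1)
  have hψ (d : τ →₀ ℕ) :
      ψ (monomial d 1) = Ideal.Quotient.mk I (monomial (Function.invFun D d) 1) := by
    simpa only [coe_basisMonomials] using (basisMonomials τ R).constr_basis R
      (fun d => Ideal.Quotient.mk I (monomial (Function.invFun D d) 1)) d
  have hcomp : ψ ∘ₗ φ = (Ideal.Quotient.mkₐ R I).toLinearMap := by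
    refine (basisMonomials σ R).ext fun a => ?_
    simp only [coe_basisMonomials, LinearMap.coe_comp, Function.comp_apply,
      AlgHom.toLinearMap_apply, hφ, hψ, Ideal.Quotient.mkₐ_eq_mk]
    exact Ideal.Quotient.eq.2 (hI _ _ (Function.invFun_eq ⟨a, rfl⟩))
  have hp' := LinearMap.congr_fun hcomp p
  rw [LinearMap.comp_apply, hp, map_zero] at hp'
  exact Ideal.Quotient.eq_zero_iff_mem.1 hp'.symm

/-- The exponents of the toric parametrization `x_i ↦ u_i s_{c i}`, `y_i ↦ u_i`, where
`u_i = X (Sum.inl i)` and `s_l = X (Sum.inr l)`. -/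
noncomputable def toricExp (c : V → ι) : V ⊕ V → (V ⊕ ι →₀ ℕ) :=
  Sum.elim (fun i => Finsupp.single (Sum.inl i) 1 + Finsupp.single (Sum.inr (c i)) 1)
    fun i => Finsupp.single (Sum.inl i) 1

/-- The toric parametrization `x_i ↦ u_i s_{c i}`, `y_i ↦ u_i`. -/
noncomputable def toricHom (R : Type*) [CommRing R] (c : V → ι) :
    MvPolynomial (V ⊕ V) R →ₐ[R] MvPolynomial (V ⊕ ι) R :=
  aeval fun s => monomial (toricExp c s) 1

/-- The action of `toricHom` on the exponents of monomials. -/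
noncomputable def toricDeg (c : V → ι) : (V ⊕ V →₀ ℕ) →ₗ[ℕ] (V ⊕ ι →₀ ℕ) :=
  Finsupp.linearCombination ℕ (toricExp c)

theorem toricHom_monomial (c : V → ι) (a : V ⊕ V →₀ ℕ) :
    toricHom R c (monomial a 1) = monomial (toricDeg c a) 1 := by
  rw [toricHom, aeval_monomial, map_one, one_mul, toricDeg, Finsupp.linearCombination_apply,
    Finsupp.sum, monomial_sum_one]
  simp [Finsupp.prod, monomial_pow]

theorem toricHom_minor {i j : V} (h : c i = c j) : toricHom R c (minor R i j) = 0 := by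
  simp only [minor, toricHom, map_sub, map_mul, aeval_X, toricExp, Sum.elim_inl, Sum.elim_inr,
    monomial_mul, h, sub_eq_zero]
  abel_nf

theorem toricDeg_inl [Finite V] (c : V → ι) (a : V ⊕ V →₀ ℕ) (i : V) :
    toricDeg c a (Sum.inl i) = a (Sum.inl i) + a (Sum.inr i) := by
  classical
  cases nonempty_fintype V
  rw [toricDeg, Finsupp.linearCombination_apply, Finsupp.sum_fintype _ _ (by simp)]
  simp [toricExp, Finsupp.single_apply]

theorem toricDeg_inr [Fintype V] [DecidableEq ι] (c : V → ι) (a : V ⊕ V →₀ ℕ) (l : ι) :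
    toricDeg c a (Sum.inr l) = ∑ i with c i = l, a (Sum.inl i) := by
  classical
  rw [toricDeg, Finsupp.linearCombination_apply, Finsupp.sum_fintype _ _ (by simp)]
  simp [toricExp, Finsupp.single_apply, Finset.sum_filter]

theorem add_eq_add_of_toricDeg_eq [Finite V] (h : toricDeg c a = toricDeg c b) (i : V) :
    a (Sum.inl i) + a (Sum.inr i) = b (Sum.inl i) + b (Sum.inr i) := by
  simpa only [toricDeg_inl] using DFunLike.congr_fun h (Sum.inl i)

theorem exists_lt_and_lt_of_toricDeg_eq [Finite V] (h : toricDeg c a = toricDeg c b)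
    (hne : a ≠ b) :
    ∃ i j, c i = c j ∧ b (Sum.inl i) < a (Sum.inl i) ∧ a (Sum.inl j) < b (Sum.inl j) := by
  classical
  cases nonempty_fintype V
  have hsum (l : ι) : ∑ i with c i = l, a (Sum.inl i) = ∑ i with c i = l, b (Sum.inl i) := by
    simpa only [toricDeg_inr] using DFunLike.congr_fun h (Sum.inr l)
  by_cases hle : ∀ i, a (Sum.inl i) ≤ b (Sum.inl i)
  · have hx (i : V) : a (Sum.inl i) = b (Sum.inl i) :=
      (Finset.sum_eq_sum_iff_of_le fun j _ => hle j).1 (hsum (c i)) i (by simp)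
    refine absurd (Finsupp.ext ?_) hne
    rintro (i | i)
    · exact hx i
    · exact Nat.add_left_cancel (hx i ▸ add_eq_add_of_toricDeg_eq h i)
  · push Not at hle
    obtain ⟨i, hi⟩ := hle
    obtain ⟨j, hj, hlt⟩ : ∃ j, c j = c i ∧ a (Sum.inl j) < b (Sum.inl j) := by
      by_contra! hcon
      exact (hsum (c i)).not_gt
        (Finset.sum_lt_sum (fun j hj => hcon j (by simpa using hj)) ⟨i, by simp, hi⟩)
    exact ⟨i, j, hj.symm, hi, hlt⟩

/-- The exponent of `x_i y_j · X ^ d`. -/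
noncomputable def crossExp (i j : V) (d : V ⊕ V →₀ ℕ) : V ⊕ V →₀ ℕ :=
  Finsupp.single (Sum.inl i) 1 + Finsupp.single (Sum.inr j) 1 + d

theorem exists_eq_crossExp {i j : V} (hi : 0 < a (Sum.inl i)) (hj : 0 < a (Sum.inr j)) :
    ∃ d, a = crossExp i j d := by
  refine ⟨_, (add_tsub_cancel_of_le (Finsupp.le_def.2 ?_)).symm⟩
  classical
  rintro (k | k)
  · rcases eq_or_ne i k with rfl | hk <;> simp [*, Nat.one_le_iff_ne_zero, hi.ne']
  · rcases eq_or_ne j k with rfl | hk <;> simp [*, Nat.one_le_iff_ne_zero, hj.ne']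

theorem toricDeg_crossExp_swap {i j : V} (h : c i = c j) (d : V ⊕ V →₀ ℕ) :
    toricDeg c (crossExp i j d) = toricDeg c (crossExp j i d) := by
  simp only [crossExp, map_add, toricDeg, Finsupp.linearCombination_single, one_smul, toricExp,
    Sum.elim_inl, Sum.elim_inr, h]
  abel

theorem monomial_crossExp_sub_swap (i j : V) (d : V ⊕ V →₀ ℕ) :
    monomial (crossExp i j d) (1 : R) - monomial (crossExp j i d) 1 =
      monomial d 1 * minor R i j := by
  simp only [crossExp, minor, X, mul_sub, monomial_mul, mul_one, add_comm d]

theorem sum_tsub_crossExp_swap_lt [Fintype V] {i j : V} {d : V ⊕ V →₀ ℕ}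
    (hi : b (Sum.inl i) < crossExp i j d (Sum.inl i))
    (hj : crossExp i j d (Sum.inl j) < b (Sum.inl j)) :
    ∑ k, (crossExp j i d (Sum.inl k) - b (Sum.inl k)) <
      ∑ k, (crossExp i j d (Sum.inl k) - b (Sum.inl k)) := by
  classical
  have hij : i ≠ j := by
    rintro rfl
    exact hi.asymm hj
  simp only [crossExp, Finsupp.add_apply, Finsupp.single_apply, Sum.inl.injEq, reduceCtorEq,
    if_true, if_false, hij] at hi hj ⊢
  refine Finset.sum_lt_sum (fun k _ => ?_) ⟨i, Finset.mem_univ i, ?_⟩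
  · by_cases hk : j = k
    · subst hk
      simp only [if_true, hij, if_false]
      omega
    · simp only [hk, if_false]
      omega
  · simp only [if_true, hij.symm, if_false]
    omega

theorem monomial_sub_monomial_mem [Finite V] (h : toricDeg c a = toricDeg c b) :
    monomial a (1 : R) - monomial b 1 ∈ relIdeal R (fun i j => c i = c j) ∅ := by
  cases nonempty_fintype V
  induction hn : ∑ i, (a (Sum.inl i) - b (Sum.inl i)) using Nat.strong_induction_on
    generalizing a with
  | _ n ih =>
  rcases eq_or_ne a b with rfl | hne
  · simp
  obtain ⟨i, j, hij, hi, hj⟩ := exists_lt_and_lt_of_toricDeg_eq h hne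
  obtain ⟨d, rfl⟩ : ∃ d, a = crossExp i j d :=
    exists_eq_crossExp (by omega) (by have := add_eq_add_of_toricDeg_eq h j; omega)
  rw [← sub_add_sub_cancel _ (monomial (crossExp j i d) (1 : R)), monomial_crossExp_sub_swap]
  exact add_mem (Ideal.mul_mem_left _ _ (minor_mem_relIdeal hij))
    (ih _ (hn ▸ sum_tsub_crossExp_swap_lt hi hj) ((toricDeg_crossExp_swap hij d).symm.trans h) rfl)

theorem relIdeal_label_eq_ker [Finite V] (c : V → ι) (T : Set V) :
    relIdeal R (fun i j => c i = c j) T =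
      RingHom.ker ((toricHom R c).comp (killVars R (cols T))) := by
  refine le_antisymm (relIdeal_le_iff.2 ⟨fun s hs => ?_, fun i j hij => ?_⟩) fun p hp => ?_
  · simp [RingHom.mem_ker, killVars_X_of_mem hs]
  · by_cases hmem : i ∈ T ∨ j ∈ T
    · simp [RingHom.mem_ker, killVars_cols_minor_of_mem hmem]
    · push Not at hmem
      simp [RingHom.mem_ker, killVars_cols_minor_of_notMem hmem.1 hmem.2, toricHom_minor hij]
  · have hkill : killVars R (cols T) p ∈ relIdeal R (fun i j => c i = c j) ∅ :=
      mem_of_map_monomial_eq_monomial (φ := (toricHom R c).toLinearMap) (toricHom_monomial c)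
        (fun _ _ => monomial_sub_monomial_mem) hp
    rw [← sub_add_cancel p (killVars R (cols T) p)]
    exact add_mem (sub_killVars_mem (fun _ => X_mem_relIdeal) p)
      (relIdeal_mono (Set.empty_subset T) (fun _ _ _ _ => Or.inr) hkill)

theorem isPrime_relIdeal_label [IsDomain R] [Finite V] (c : V → ι) (T : Set V) :
    (relIdeal R (fun i j => c i = c j) T).IsPrime := by
  rw [relIdeal_label_eq_ker]
  exact RingHom.ker_isPrime _

end Toric

section Height

theorem exists_isPrime_between {R : Type*} [CommRing R] [Nontrivial R] {V : Type*}
    {r : V → V → Prop} {T : Set V} (hprime : (relIdeal R r T).IsPrime) {v : V} (hv : v ∉ T)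
    (hr : ∀ i j, r i j → i ≠ v ∧ j ≠ v) :
    ∃ P : Ideal (MvPolynomial (V ⊕ V) R), P.IsPrime ∧
      relIdeal R r T < P ∧ P < relIdeal R r (insert v T) := by
  let ρ := killVars R {(Sum.inl v : V ⊕ V)}
  have hfix {s : V ⊕ V} (hs : s ≠ Sum.inl v) : ρ (X s) = X s := killVars_X_of_notMem hs
  have hle : relIdeal R r T ≤ (relIdeal R r T).comap ρ := by
    refine relIdeal_le_iff.2 ⟨fun s hs => ?_, fun i j hij => ?_⟩
    · rw [Ideal.mem_comap, hfix (by rintro rfl; exact hv hs)]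
      exact X_mem_relIdeal hs
    · obtain ⟨hi, hj⟩ := hr i j hij
      have hminor : ρ (minor R i j) = minor R i j := by simp [minor, hfix, hi, hj]
      rw [Ideal.mem_comap, hminor]
      exact minor_mem_relIdeal hij
  have hxv : X (Sum.inl v) ∈ (relIdeal R r T).comap ρ := by
    simp [ρ, killVars_X_of_mem]
  have hins : relIdeal R r T ≤ relIdeal R r (insert v T) :=
    relIdeal_mono (Set.subset_insert v T) fun _ _ _ _ => Or.inr
  refine ⟨(relIdeal R r T).comap ρ, hprime.comap ρ,
    lt_of_le_not_ge hle fun h => hv (X_mem_relIdeal_iff.1 (h hxv)),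
    lt_of_le_not_ge (fun p hp => ?_) fun h => ?_⟩
  · rw [← sub_add_cancel p (ρ p)]
    refine add_mem (sub_killVars_mem ?_ p) (hins hp)
    rintro s rfl
    exact X_mem_relIdeal (inl_mem_cols.2 (Set.mem_insert v T))
  · have hyv : ρ (X (Sum.inr v)) ∈ relIdeal R r T :=
      h (X_mem_relIdeal (inr_mem_cols.2 (Set.mem_insert v T)))
    rw [hfix Sum.inr_ne_inl] at hyv
    exact hv (X_mem_relIdeal_iff.1 hyv)

theorem height_add_coheight_le_ringKrullDim {R : Type*} [CommRing R] {d : ℕ}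
    (hd : ringKrullDim R = d) (P : PrimeSpectrum R) :
    Order.height P + Order.coheight P ≤ d := by
  have : Nonempty (PrimeSpectrum R) := ⟨P⟩
  rw [ringKrullDim, Order.krullDim_eq_iSup_height_add_coheight_of_nonempty] at hd
  have hd' : ⨆ Q : PrimeSpectrum R, Order.height Q + Order.coheight Q = d := by exact_mod_cast hd
  exact hd' ▸ le_iSup (fun Q : PrimeSpectrum R => Order.height Q + Order.coheight Q) P

variable {V ι : Type*} {c : V → ι} {T : Set V} {v : V}

theorem compl_eq_insert_compl_insert (hv : v ∉ T) : Tᶜ = insert v (insert v T)ᶜ := by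
  ext w
  by_cases hw : w = v <;> simp [hw, hv]

/-- The dimension of the variety cut out by `labelPrime K c T`: one parameter for each remaining
vertex and one for each label in use. -/
noncomputable def labelDim (c : V → ι) (T : Set V) : ℕ := Tᶜ.ncard + (c '' Tᶜ).ncard

theorem labelDim_empty_of_injective (hc : Function.Injective c) :
    labelDim c ∅ = 2 * Nat.card V := by
  rw [labelDim, Set.ncard_image_of_injective _ hc, Set.compl_empty, Set.ncard_univ, two_mul]

open Classical in
/-- The labelling `c` with a new label for the vertex `v`. -/
noncomputable def isolate (c : V → ι) (v : V) : V → Option ι := Function.update (some ∘ c) v none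

@[simp] theorem isolate_self (c : V → ι) (v : V) : isolate c v v = none := by simp [isolate]

@[simp] theorem isolate_of_ne (c : V → ι) {w : V} (h : w ≠ v) : isolate c v w = some (c w) := by
  simp [isolate, h]

theorem eq_of_isolate_eq (c : V → ι) {i j : V} (h : isolate c v i = isolate c v j) :
    c i = c j := by
  by_cases hi : i = v <;> by_cases hj : j = v <;> simp_all

theorem isolate_eq_isolate_self_iff (c : V → ι) {w : V} :
    isolate c v w = isolate c v v ↔ w = v := by
  by_cases hw : w = v <;> simp [hw]

theorem isolate_image (c : V → ι) {U : Set V} (hv : v ∉ U) :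
    isolate c v '' U = some '' (c '' U) := by
  rw [Set.image_image]
  exact Set.image_congr fun w hw => isolate_of_ne c (by rintro rfl; exact hv hw)

theorem labelDim_isolate_of_mem (c : V → ι) (hv : v ∈ T) :
    labelDim (isolate c v) T = labelDim c T := by
  rw [labelDim, isolate_image c (by simpa),
    Set.ncard_image_of_injective _ (Option.some_injective ι), labelDim]

variable [Finite V]

theorem labelDim_le (c : V → ι) (T : Set V) : labelDim c T ≤ 2 * Nat.card V := by
  have hcompl := Set.ncard_le_card Tᶜ
  have himage := Set.ncard_image_le (f := c) (Set.toFinite Tᶜ)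
  rw [labelDim]
  omega

theorem labelDim_eq_add_one {w : V} (hv : v ∉ T) (hw : w ∉ T) (hwv : w ≠ v) (hc : c w = c v) :
    labelDim c T = labelDim c (insert v T) + 1 := by
  have hmem : c v ∈ c '' (insert v T)ᶜ := ⟨w, by simp [hw, hwv], hc⟩
  rw [labelDim, compl_eq_insert_compl_insert hv, Set.image_insert_eq, Set.insert_eq_of_mem hmem,
    Set.ncard_insert_of_notMem (by simp), labelDim]
  omega

theorem labelDim_eq_add_two (hv : v ∉ T) (h : ∀ w ∉ T, c w = c v → w = v) :
    labelDim c T = labelDim c (insert v T) + 2 := by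
  have hnotMem : c v ∉ c '' (insert v T)ᶜ := by
    rintro ⟨w, hw, hc⟩
    rw [Set.mem_compl_iff, Set.mem_insert_iff, not_or] at hw
    exact hw.1 (h w hw.2 hc)
  rw [labelDim, compl_eq_insert_compl_insert hv, Set.image_insert_eq,
    Set.ncard_insert_of_notMem hnotMem, Set.ncard_insert_of_notMem (by simp), labelDim]
  omega

theorem labelDim_isolate {i j : V} (hij : i ≠ j) (hc : c i = c j) (hi : i ∉ T) (hj : j ∉ T) :
    labelDim (isolate c i) T = labelDim c T + 1 := by
  rw [labelDim_eq_add_two hi fun w _ => (isolate_eq_isolate_self_iff c).1,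
    labelDim_isolate_of_mem c (Set.mem_insert i T),
    labelDim_eq_add_one hi hj hij.symm hc.symm]

variable (K : Type*) [Field K]

/-- The prime ideal attached to a labelling `c` of the vertices and a set `T` of killed vertices, as
a point of the spectrum. -/
noncomputable def labelPrime (c : V → ι) (T : Set V) : PrimeSpectrum (MvPolynomial (V ⊕ V) K) :=
  ⟨relIdeal K (fun i j => c i = c j) T, isPrime_relIdeal_label c T⟩

variable {K}

theorem labelPrime_le_labelPrime {κ : Type*} {c' : V → κ}
    (h : ∀ i j, i ∉ T → j ∉ T → c i = c j → c' i = c' j) :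
    labelPrime K c T ≤ labelPrime K c' T :=
  relIdeal_mono subset_rfl fun i j hi hj hij => Or.inr (h i j hi hj hij)

theorem labelPrime_lt_insert (c : V → ι) (hv : v ∉ T) :
    labelPrime K c T < labelPrime K c (insert v T) :=
  lt_of_le_not_ge (relIdeal_mono (Set.subset_insert v T) fun _ _ _ _ => Or.inr) fun h =>
    hv (X_mem_relIdeal_iff.1 (h (X_mem_relIdeal (inl_mem_cols.2 (Set.mem_insert v T)))))

theorem exists_labelPrime_between (hv : v ∉ T) (h : ∀ w ∉ T, c w = c v → w = v) :
    ∃ P, labelPrime K c T < P ∧ P < labelPrime K c (insert v T) := by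
  let r i j := c i = c j ∧ i ≠ v ∧ j ≠ v
  have hrel {T' : Set V} (hT : T ⊆ T') :
      relIdeal K (fun i j => c i = c j) T' = relIdeal K r T' := by
    refine le_antisymm (relIdeal_mono subset_rfl fun i j hi hj hij => ?_)
      (relIdeal_mono subset_rfl fun _ _ _ _ hij => Or.inr hij.1)
    refine or_iff_not_imp_left.2 fun hne => ⟨hij, ?_, ?_⟩
    · rintro rfl
      exact hne (h j (fun hj' => hj (hT hj')) hij.symm).symm
    · rintro rfl
      exact hne (h i (fun hi' => hi (hT hi')) hij)
  obtain ⟨P, hP, hTP, hPT⟩ := exists_isPrime_between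
    (hrel subset_rfl ▸ isPrime_relIdeal_label (R := K) c T) hv fun i j hij => hij.2
  rw [← hrel subset_rfl] at hTP
  rw [← hrel (Set.subset_insert v T)] at hPT
  exact ⟨⟨P, hP⟩, hTP, hPT⟩

theorem labelDim_le_coheight (c : V → ι) (T : Set V) :
    (labelDim c T : ℕ∞) ≤ Order.coheight (labelPrime K c T) := by
  induction T using WellFoundedGT.induction with
  | ind T ih =>
  rcases eq_or_ne T Set.univ with rfl | hT
  · simp [labelDim]
  obtain ⟨v, hv⟩ := (Set.ne_univ_iff_exists_notMem T).1 hT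
  have ih := ih _ (Set.ssubset_insert hv)
  by_cases h : ∀ w ∉ T, c w = c v → w = v
  · obtain ⟨P, hTP, hPT⟩ := exists_labelPrime_between (K := K) hv h
    calc (labelDim c T : ℕ∞) = labelDim c (insert v T) + 1 + 1 := by
          rw [labelDim_eq_add_two hv h]; rfl
      _ ≤ Order.coheight (labelPrime K c (insert v T)) + 1 + 1 := by gcongr
      _ ≤ Order.coheight P + 1 := by gcongr; exact Order.coheight_add_one_le hPT
      _ ≤ _ := Order.coheight_add_one_le hTP
  · push Not at h
    obtain ⟨w, hw, hc, hne⟩ := h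
    calc (labelDim c T : ℕ∞) = labelDim c (insert v T) + 1 := by
          rw [labelDim_eq_add_one hv hw hne hc]; rfl
      _ ≤ Order.coheight (labelPrime K c (insert v T)) + 1 := by gcongr
      _ ≤ _ := Order.coheight_add_one_le (labelPrime_lt_insert c hv)

theorem labelPrime_isolate_of_mem (c : V → ι) (hv : v ∈ T) :
    labelPrime K (isolate c v) T = labelPrime K c T := by
  refine le_antisymm (labelPrime_le_labelPrime fun i j _ _ => eq_of_isolate_eq c)
    (labelPrime_le_labelPrime fun i j hi hj hij => ?_)
  rw [isolate_of_ne c (by rintro rfl; exact hi hv), isolate_of_ne c (by rintro rfl; exact hj hv),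
    hij]

theorem labelPrime_isolate_lt {i j : V} (hij : i ≠ j) (hc : c i = c j) (hi : i ∉ T) (hj : j ∉ T) :
    labelPrime K (isolate c i) T < labelPrime K c T := by
  refine lt_of_le_not_ge (labelPrime_le_labelPrime fun _ _ _ _ => eq_of_isolate_eq c) fun hle => ?_
  have heq := rel_of_minor_mem_relIdeal (r := fun a b => isolate c i a = isolate c i b)
    ⟨fun _ => rfl, Eq.symm, Eq.trans⟩ hj hi (hle (minor_mem_relIdeal hc.symm))
  exact hij ((isolate_eq_isolate_self_iff c).1 heq).symm

theorem two_mul_card_le_height_add (c : V → ι) (T : Set V) :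
    (2 * Nat.card V : ℕ) ≤ Order.height (labelPrime K c T) + labelDim c T := by
  induction h : 2 * Nat.card V - labelDim c T using Nat.strong_induction_on generalizing ι c T with
  | h _ ih =>
  subst h
  rcases T.eq_empty_or_nonempty with rfl | ⟨v, hv⟩
  · by_cases hc : Function.Injective c
    · rw [labelDim_empty_of_injective hc]
      exact le_add_self
    obtain ⟨i, j, hcij, hij⟩ := Function.not_injective_iff.1 hc
    have hdim := labelDim_isolate hij hcij (Set.notMem_empty i) (Set.notMem_empty j)
    have hle := labelDim_le (isolate c i) ∅
    calc _ ≤ Order.height (labelPrime K (isolate c i) ∅) + labelDim (isolate c i) ∅ :=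
          ih _ (by omega) _ _ rfl
      _ = Order.height (labelPrime K (isolate c i) ∅) + 1 + labelDim c ∅ := by
          rw [hdim]; push_cast; ring
      _ ≤ _ := by
          gcongr
          exact Order.height_add_one_le
            (labelPrime_isolate_lt hij hcij (Set.notMem_empty i) (Set.notMem_empty j))
  · let U : Set V := T \ {v}
    have hvU : v ∉ U := by simp [U]
    have hinsert : insert v U = T := Set.insert_sdiff_self_of_mem hv
    have hisolated : ∀ w ∉ U, isolate c v w = isolate c v v → w = v :=
      fun w _ => (isolate_eq_isolate_self_iff c).1
    obtain ⟨P, hUP, hPT⟩ := exists_labelPrime_between (K := K) hvU hisolated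
    rw [hinsert, labelPrime_isolate_of_mem c hv] at hPT
    have hdim := labelDim_eq_add_two hvU hisolated
    rw [hinsert, labelDim_isolate_of_mem c hv] at hdim
    have hle := labelDim_le (isolate c v) U
    calc _ ≤ Order.height (labelPrime K (isolate c v) U) + labelDim (isolate c v) U :=
          ih _ (by omega) _ _ rfl
      _ = Order.height (labelPrime K (isolate c v) U) + 1 + 1 + labelDim c T := by
          rw [hdim]; push_cast; ring
      _ ≤ Order.height P + 1 + labelDim c T := by gcongr; exact Order.height_add_one_le hUP
      _ ≤ _ := by gcongr; exact Order.height_add_one_le hPT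

theorem height_relIdeal_label_add (c : V → ι) (T : Set V) :
    (relIdeal K (fun i j => c i = c j) T).height + labelDim c T = (2 * Nat.card V : ℕ) := by
  have hdim : ringKrullDim (MvPolynomial (V ⊕ V) K) = (2 * Nat.card V : ℕ) := by
    rw [MvPolynomial.ringKrullDim_of_isNoetherianRing, ringKrullDim_eq_zero_of_field, Nat.card_sum]
    simp [two_mul]
  change (labelPrime K c T).asIdeal.height + _ = _
  rw [PrimeSpectrum.height_eq_orderHeight]
  refine le_antisymm ?_ (two_mul_card_le_height_add c T)
  exact (add_le_add_right (labelDim_le_coheight c T) _).trans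
    (height_add_coheight_le_ringKrullDim hdim _)

end Height

section Components

variable {V : Type*} {G : SimpleGraph V} {S T : Set V}

/-- The number of connected components of `G - S`. In `deleteVerts G S` the vertices of `S` are
still present, as isolated vertices, so only the components of the other vertices are counted. -/
noncomputable def numComp (G : SimpleGraph V) (S : Set V) : ℕ :=
  ((deleteVerts G S).connectedComponentMk '' Sᶜ).ncard

theorem numComp_empty (hconn : G.Connected) : numComp G ∅ = 1 := by
  have hG : deleteVerts G ∅ = G := by
    ext
    simp [deleteVerts]
  have := hconn.preconnected.subsingleton_connectedComponent
  have hrange : Set.range G.connectedComponentMk = Set.univ := Quot.mk_surjective.range_eq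
  rw [numComp, hG, Set.compl_empty, Set.image_univ, hrange, Set.ncard_univ]
  exact Nat.card_of_subsingleton (G.connectedComponentMk hconn.nonempty.some)

theorem isPrime_componentIdeal [Finite V] (R : Type*) [CommRing R] [IsDomain R]
    (G : SimpleGraph V) (S : Set V) : (componentIdeal R G S).IsPrime := by
  simpa only [SimpleGraph.ConnectedComponent.eq, componentIdeal] using
    isPrime_relIdeal_label (R := R) (deleteVerts G S).connectedComponentMk S

theorem height_componentIdeal_add [Finite V] (K : Type*) [Field K] (G : SimpleGraph V)
    (S : Set V) :
    (componentIdeal K G S).height + numComp G S = (Nat.card V + S.ncard : ℕ) := by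
  have hheight := height_relIdeal_label_add (K := K) (deleteVerts G S).connectedComponentMk S
  simp only [SimpleGraph.ConnectedComponent.eq] at hheight
  change (componentIdeal K G S).height + ((Sᶜ.ncard + numComp G S : ℕ) : ℕ∞) = _ at hheight
  have hcard := Set.ncard_add_ncard_compl S
  refine ENat.add_left_injective_of_ne_top (ENat.natCast_ne_top Sᶜ.ncard) ?_
  calc _ = (componentIdeal K G S).height + ((Sᶜ.ncard + numComp G S : ℕ) : ℕ∞) := by
        push_cast; ring
    _ = (2 * Nat.card V : ℕ) := hheight
    _ = (Nat.card V + S.ncard + Sᶜ.ncard : ℕ) := by congr 1; omega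
    _ = _ := Nat.cast_add _ _

theorem height_componentIdeal_eq_iff [Finite V] {K : Type*} [Field K] (hconn : G.Connected) :
    (componentIdeal K G S).height = (componentIdeal K G ∅).height ↔
      numComp G S = S.ncard + 1 := by
  have hS := height_componentIdeal_add K G S
  have hempty := height_componentIdeal_add K G ∅
  rw [numComp_empty hconn] at hempty
  generalize (componentIdeal K G S).height = x at *
  generalize (componentIdeal K G ∅).height = y at *
  lift x to ℕ using by rintro rfl; exact ENat.top_ne_natCast _ (by simpa only [top_add] using hS)
  lift y to ℕ using by
    rintro rfl; exact ENat.top_ne_natCast _ (by simpa only [top_add] using hempty)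
  norm_cast at hS hempty ⊢
  simp only [Set.ncard_empty] at hempty
  omega

theorem componentIdeal_le_iff {R : Type*} [CommRing R] [Nontrivial R] :
    componentIdeal R G T ≤ componentIdeal R G S ↔
      T ⊆ S ∧ ∀ i j, i ∉ S → j ∉ S →
        (deleteVerts G T).Reachable i j → (deleteVerts G S).Reachable i j := by
  refine ⟨fun h => ⟨fun v hv => X_mem_relIdeal_iff.1
    (h (X_mem_relIdeal (inl_mem_cols.2 hv))), fun i j hi hj hij => ?_⟩,
    fun h => relIdeal_mono h.1 fun i j hi hj hij => Or.inr (h.2 i j hi hj hij)⟩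
  exact rel_of_minor_mem_relIdeal (SimpleGraph.reachable_is_equivalence _) hi hj
    (h (minor_mem_relIdeal hij))

/-- The cut property of `S`: every vertex `v` of `S` is a cut vertex of `G - (S \ {v})`, that is,
`v` has neighbours in two components of `G - S`. -/
def HasCutProperty (G : SimpleGraph V) (S : Set V) : Prop :=
  ∀ v ∈ S, ∃ a b, a ∉ S ∧ b ∉ S ∧ G.Adj v a ∧ G.Adj v b ∧ ¬ (deleteVerts G S).Reachable a b

theorem HasCutProperty.eq_of_componentIdeal_le {R : Type*} [CommRing R] [Nontrivial R]
    (hS : HasCutProperty G S) (h : componentIdeal R G T ≤ componentIdeal R G S) : T = S := by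
  obtain ⟨hTS, hreach⟩ := componentIdeal_le_iff.1 h
  refine hTS.antisymm fun v hv => ?_
  by_contra hvT
  obtain ⟨a, b, ha, hb, hva, hvb, hab⟩ := hS v hv
  have hav : (deleteVerts G T).Adj a v := ⟨hva.symm, fun h => ha (hTS h), hvT⟩
  have hbv : (deleteVerts G T).Adj v b := ⟨hvb, hvT, fun h => hb (hTS h)⟩
  exact hab (hreach a b ha hb (hav.reachable.trans hbv.reachable))

theorem reachable_deleteVerts_of_diff_singleton {v : V} (hv : v ∈ S)
    (hnbhd : ∀ a b, a ∉ S → b ∉ S → G.Adj v a → G.Adj v b → (deleteVerts G S).Reachable a b)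
    {i j : V} (p : (deleteVerts G (S \ {v})).Walk i j) (hj : j ∉ S) {a : V} (ha : a ∉ S)
    (hai : a = i ∨ i = v ∧ G.Adj v a) : (deleteVerts G S).Reachable a j := by
  induction p generalizing a with
  | nil =>
    obtain rfl | ⟨rfl, -⟩ := hai
    · exact .rfl
    · exact absurd hv hj
  | @cons i k j hik p ih =>
    obtain ⟨hik, -, hk⟩ := hik
    have hkS (hkv : k ≠ v) : k ∉ S := fun h => hk ⟨h, hkv⟩
    obtain rfl | ⟨rfl, hva⟩ := hai
    · by_cases hkv : k = v
      · exact ih hj ha (Or.inr ⟨hkv, hkv ▸ hik.symm⟩)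
      · have hak : (deleteVerts G S).Adj a k := ⟨hik, ha, hkS hkv⟩
        exact hak.reachable.trans (ih hj (hkS hkv) (Or.inl rfl))
    · have hk := hkS hik.ne'
      exact (hnbhd a k ha hk hva hik).trans (ih hj hk (Or.inl rfl))

theorem hasCutProperty_iff_minimal {R : Type*} [CommRing R] [Nontrivial R] :
    HasCutProperty G S ↔
      Minimal (· ∈ Set.range (componentIdeal R G)) (componentIdeal R G S) := by
  refine ⟨fun hS => ⟨⟨S, rfl⟩, ?_⟩, fun h => ?_⟩
  · rintro _ ⟨T, rfl⟩ hle
    rw [hS.eq_of_componentIdeal_le hle]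
  · by_contra hcut
    simp only [HasCutProperty] at hcut
    push Not at hcut
    obtain ⟨v, hv, hnbhd⟩ := hcut
    have hle : componentIdeal R G (S \ {v}) ≤ componentIdeal R G S :=
      componentIdeal_le_iff.2 ⟨Set.sdiff_subset, fun i j hi hj ⟨p⟩ =>
        reachable_deleteVerts_of_diff_singleton hv hnbhd p hj hi (Or.inl rfl)⟩
    exact ((componentIdeal_le_iff.1 (h.2 ⟨_, rfl⟩ hle)).1 hv).2 rfl

theorem isUnmixed_binomialEdgeIdeal_iff [Finite V] (K : Type*) [Field K] (hconn : G.Connected) :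
    IsUnmixed (binomialEdgeIdeal K G) ↔
      ∀ S, HasCutProperty G S → numComp G S = S.ncard + 1 := by
  have hmem {Q : Ideal (MvPolynomial (V ⊕ V) K)} :
      Q ∈ associatedPrimes _ (MvPolynomial (V ⊕ V) K ⧸ binomialEdgeIdeal K G) ↔
        Minimal (· ∈ Set.range (componentIdeal K G)) Q := by
    rw [binomialEdgeIdeal_eq_iInf]
    exact mem_associatedPrimes_quotient_iInf_iff (isPrime_componentIdeal K G)
  have hempty : HasCutProperty G ∅ := fun v hv => absurd hv (Set.notMem_empty v)
  rw [isUnmixed_iff_of_mem_associatedPrimes (hmem.2 (hasCutProperty_iff_minimal.1 hempty))]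
  refine ⟨fun h S hS => (height_componentIdeal_eq_iff hconn).1
    (h _ (hmem.2 (hasCutProperty_iff_minimal.1 hS))), fun h P hP => ?_⟩
  obtain ⟨S, rfl⟩ := (hmem.1 hP).1
  exact (height_componentIdeal_eq_iff hconn).2 (h S (hasCutProperty_iff_minimal.2 (hmem.1 hP)))

end Components

section Chordal

variable {V : Type*} {G : SimpleGraph V} {u w : V}

theorem exists_walk_shorter_of_getVert_adj (q : G.Walk u w) {l k : ℕ} (hlk : l + 1 < k)
    (hk : k ≤ q.length) (h : G.Adj (q.getVert l) (q.getVert k)) :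
    ∃ p : G.Walk u w, p.length < q.length ∧ p.support ⊆ q.support := by
  refine ⟨(q.take l).append (.cons h (q.drop k)), ?_, fun z hz => ?_⟩
  · simp only [SimpleGraph.Walk.length_append, SimpleGraph.Walk.take_length,
      SimpleGraph.Walk.length_cons, SimpleGraph.Walk.drop_length]
    omega
  · rw [SimpleGraph.Walk.mem_support_append_iff, SimpleGraph.Walk.support_cons,
      List.mem_cons] at hz
    rcases hz with hz | rfl | hz
    exacts [(q.isSubwalk_take l).support_subset hz, q.getVert_mem_support l,
      (q.isSubwalk_drop k).support_subset hz]

theorem exists_walk_shorter (q : G.Walk u w) {x y : V} (hx : x ∈ q.support) (hy : y ∈ q.support)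
    (hxy : G.Adj x y) (he : s(x, y) ∉ q.edges) :
    ∃ p : G.Walk u w, p.length < q.length ∧ p.support ⊆ q.support := by
  obtain ⟨l, rfl, hl⟩ := SimpleGraph.Walk.mem_support_iff_exists_getVert.1 hx
  obtain ⟨k, rfl, hk⟩ := SimpleGraph.Walk.mem_support_iff_exists_getVert.1 hy
  wlog hlk : l ≤ k generalizing l k
  · exact this k hk hy l hl hx hxy.symm (by rwa [Sym2.eq_swap]) (by omega)
  have hne : k ≠ l := by
    rintro rfl
    exact hxy.ne rfl
  have hne_succ : k ≠ l + 1 := by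
    rintro rfl
    exact he (q.mk_mem_edges_iff_exists.2 ⟨l, by omega, rfl⟩)
  exact exists_walk_shorter_of_getVert_adj q (by omega) hk hxy

theorem IsChordal.exists_neighbor_or_chord (hG : IsChordal G) {a : V} {q : G.Walk u w}
    (hq : q.IsPath) (ha : a ∉ q.support) (hau : G.Adj a u) (haw : G.Adj a w)
    (hlen : 2 ≤ q.length) :
    (∃ y ∈ q.support, y ≠ u ∧ y ≠ w ∧ G.Adj a y) ∨
      ∃ x ∈ q.support, ∃ y ∈ q.support, G.Adj x y ∧ s(x, y) ∉ q.edges := by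
  have huw : u ≠ w := by
    rintro rfl
    simp [(SimpleGraph.Walk.isPath_iff_nil.1 hq).eq_nil] at hlen
  have hcyc : (SimpleGraph.Walk.cons hau (q.concat haw.symm)).IsCycle := by
    rw [SimpleGraph.Walk.cons_isCycle_iff, SimpleGraph.Walk.edges_concat, List.concat_eq_append,
      List.mem_append, List.mem_singleton, Sym2.eq_swap, Sym2.congr_left]
    exact ⟨hq.concat ha _,
      not_or.2 ⟨fun h => ha (q.snd_mem_support_of_mem_edges h), huw⟩⟩
  obtain ⟨x, hx, y, hy, hxy, he⟩ := hG a _ hcyc (by simp; omega)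
  simp only [SimpleGraph.Walk.support_cons, SimpleGraph.Walk.support_concat, List.mem_cons,
    List.mem_append, List.not_mem_nil, or_false] at hx hy
  simp only [SimpleGraph.Walk.edges_cons, SimpleGraph.Walk.edges_concat, List.mem_cons,
    List.concat_eq_append, List.mem_append, List.not_mem_nil, or_false, not_or] at he
  have hx' : x = a ∨ x ∈ q.support := by tauto
  have hy' : y = a ∨ y ∈ q.support := by tauto
  rcases hx' with rfl | hxq <;> rcases hy' with rfl | hyq
  · exact absurd rfl hxy.ne
  · refine Or.inl ⟨y, hyq, ?_, ?_, hxy⟩ <;> rintro rfl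
    exacts [he.1 rfl, he.2.2 Sym2.eq_swap]
  · refine Or.inl ⟨x, hxq, ?_, ?_, hxy.symm⟩ <;> rintro rfl
    exacts [he.1 Sym2.eq_swap, he.2.2 rfl]
  · exact Or.inr ⟨x, hxq, y, hyq, hxy, he.2.1⟩

theorem eq_or_eq_of_mem_support {q : G.Walk u w} (hlen : q.length < 2) {x : V}
    (hx : x ∈ q.support) : x = u ∨ x = w := by
  match q with
  | .nil => simpa using hx
  | .cons _ .nil => simpa using hx
  | .cons _ (.cons _ _) => simp at hlen

theorem IsChordal.exists_walk_neighbors (hG : IsChordal G) {a : V} (q : G.Walk u w)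
    (ha : a ∉ q.support) (hau : G.Adj a u) (haw : G.Adj a w) :
    ∃ p : G.Walk u w, p.support ⊆ q.support ∧ ∀ x ∈ p.support, G.Adj a x := by
  classical
  induction hn : q.length using Nat.strong_induction_on generalizing u w with
  | _ n ih =>
  subst hn
  have hsub := q.support_bypass_subset_support
  have hle := q.length_bypass_le_length
  have ha' : a ∉ q.bypass.support := fun h => ha (hsub h)
  rcases Nat.lt_or_ge q.bypass.length 2 with hlen | hlen
  · refine ⟨q.bypass, hsub, fun x hx => ?_⟩
    obtain rfl | rfl := eq_or_eq_of_mem_support hlen hx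
    exacts [hau, haw]
  obtain ⟨y, hy, hyu, hyw, hay⟩ | ⟨x, hx, y, hy, hxy, he⟩ :=
    hG.exists_neighbor_or_chord q.bypass_isPath ha' hau haw hlen
  · have htake := q.bypass.support_takeUntil_subset_support hy
    have hdrop := q.bypass.support_dropUntil_subset_support hy
    obtain ⟨p, hp, hpa⟩ := ih _ ((q.bypass.length_takeUntil_lt_length hy hyw).trans_le hle)
      _ (fun h => ha' (htake h)) hau hay rfl
    obtain ⟨p', hp', hpa'⟩ := ih _ ((q.bypass.length_dropUntil_lt_length hy hyu).trans_le hle)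
      _ (fun h => ha' (hdrop h)) hay haw rfl
    refine ⟨p.append p', fun x hx => ?_, fun x hx => ?_⟩ <;>
      rw [SimpleGraph.Walk.mem_support_append_iff] at hx
    exacts [hsub (hx.elim (fun h => htake (hp h)) fun h => hdrop (hp' h)),
      hx.elim (hpa x) (hpa' x)]
  · obtain ⟨p, hlt, hp⟩ := exists_walk_shorter q.bypass hx hy hxy he
    obtain ⟨p', hp', hpa'⟩ := ih _ (hlt.trans_le hle) p (fun h => ha' (hp h)) hau haw rfl
    exact ⟨p', fun x hx => hsub (hp (hp' hx)), hpa'⟩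

end Chordal

section Junctions

variable {V : Type*} {G : SimpleGraph V} {F F' : Finset V} {a b : V}

theorem IsMaxClique.adj (hF : IsMaxClique G F) (ha : a ∈ F) (hb : b ∈ F) (h : a ≠ b) :
    G.Adj a b := hF.prop ha hb h

theorem IsMaxClique.eq_of_subset (hF : IsMaxClique G F) (hF' : IsMaxClique G F') (h : F ⊆ F') :
    F = F' := hF.eq_of_le hF'.prop h

theorem exists_isMaxClique_of_isClique [Finite V] {s : Finset V} (hs : G.IsClique (s : Set V)) :
    ∃ F, s ⊆ F ∧ IsMaxClique G F :=
  (Set.toFinite {s : Finset V | G.IsClique (s : Set V)}).exists_le_maximal hs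

theorem exists_isMaxClique_of_adj [Finite V] (h : G.Adj a b) :
    ∃ F, IsMaxClique G F ∧ a ∈ F ∧ b ∈ F := by
  classical
  obtain ⟨F, hs, hF⟩ := exists_isMaxClique_of_isClique (G := G) (s := {a, b})
    (by simpa [SimpleGraph.isClique_pair] using fun _ => h)
  exact ⟨F, hF, hs (by simp), hs (by simp)⟩

theorem exists_isMaxClique_of_mem [Finite V] (G : SimpleGraph V) (a : V) :
    ∃ F, IsMaxClique G F ∧ a ∈ F := by
  obtain ⟨F, hs, hF⟩ := exists_isMaxClique_of_isClique (G := G) (s := {a}) (by simp)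
  exact ⟨F, hF, hs (by simp)⟩

theorem reachable_of_isClique {F S : Set V} (hF : G.IsClique F) (ha : a ∈ F) (hb : b ∈ F)
    (haS : a ∉ S) (hbS : b ∉ S) : (deleteVerts G S).Reachable a b := by
  rcases eq_or_ne a b with rfl | h
  · exact .rfl
  · exact SimpleGraph.Adj.reachable (G := deleteVerts G S) ⟨hF ha hb h, haS, hbS⟩

theorem exists_walk_of_reachable_deleteVerts {S : Set V} (h : (deleteVerts G S).Reachable a b)
    (ha : a ∉ S) : ∃ p : G.Walk a b, ∀ x ∈ p.support, x ∉ S := by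
  obtain ⟨p⟩ := h
  induction p with
  | nil => exact ⟨.nil, by simpa using ha⟩
  | cons h _ ih =>
    obtain ⟨p, hp⟩ := ih h.2.2
    exact ⟨.cons h.1 p, by simpa using ⟨ha, hp⟩⟩

variable [DecidableEq V]

/-- A junction is a nonempty intersection of two distinct maximal cliques. In a connected
generalized block graph the junctions are the minimal cut sets. -/
def IsJunction (G : SimpleGraph V) (A : Finset V) : Prop :=
  A.Nonempty ∧ ∃ F₁ F₂, IsMaxClique G F₁ ∧ IsMaxClique G F₂ ∧ F₁ ≠ F₂ ∧ F₁ ∩ F₂ = A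

variable {A B : Finset V}

theorem IsJunction.isClique (hA : IsJunction G A) : G.IsClique (A : Set V) := by
  obtain ⟨-, F₁, F₂, hF₁, -, -, rfl⟩ := hA
  exact hF₁.prop.subset (by exact_mod_cast Finset.inter_subset_left)

theorem IsJunction.not_subset (hA : IsJunction G A) (hF : IsMaxClique G F) : ¬ F ⊆ A := by
  obtain ⟨-, F₁, F₂, hF₁, hF₂, hne, rfl⟩ := hA
  intro h
  have hFF₁ := hF.eq_of_subset hF₁ (h.trans Finset.inter_subset_left)
  have hFF₂ := hF.eq_of_subset hF₂ (h.trans Finset.inter_subset_right)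
  exact hne (hFF₁.symm.trans hFF₂)

theorem IsJunction.subset_of_mem (hA : IsJunction G A) (hG : IsGeneralizedBlockGraph G)
    (hF : IsMaxClique G F) (ha : a ∈ A) (haF : a ∈ F) : A ⊆ F := by
  obtain ⟨-, F₁, F₂, hF₁, hF₂, hne, rfl⟩ := hA
  rcases eq_or_ne F₁ F with rfl | hne₁
  · exact Finset.inter_subset_left
  rcases eq_or_ne F₂ F with rfl | hne₂
  · exact Finset.inter_subset_right
  rw [(hG.2 F₁ F₂ F hF₁ hF₂ hF hne hne₁ hne₂ ⟨a, Finset.mem_inter.2 ⟨ha, haF⟩⟩).1]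
  exact Finset.inter_subset_right

theorem IsJunction.subset_of_mem_of_mem (hA : IsJunction G A) (hB : IsJunction G B)
    (hG : IsGeneralizedBlockGraph G) (ha : a ∈ A) (hb : a ∈ B) : A ⊆ B := by
  obtain ⟨-, F₁, F₂, hF₁, hF₂, -, rfl⟩ := hB
  rw [Finset.mem_inter] at hb
  exact Finset.subset_inter (hA.subset_of_mem hG hF₁ ha hb.1) (hA.subset_of_mem hG hF₂ ha hb.2)

theorem IsJunction.disjoint (hA : IsJunction G A) (hB : IsJunction G B)
    (hG : IsGeneralizedBlockGraph G) (hne : A ≠ B) : Disjoint A B := by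
  rw [Finset.disjoint_left]
  exact fun a ha hb => hne ((hA.subset_of_mem_of_mem hB hG ha hb).antisymm
    (hB.subset_of_mem_of_mem hA hG hb ha))

theorem IsJunction.inter_eq (hA : IsJunction G A) (hG : IsGeneralizedBlockGraph G)
    (hF : IsMaxClique G F) (hF' : IsMaxClique G F') (hne : F ≠ F') (h : A ⊆ F) (h' : A ⊆ F') :
    F ∩ F' = A := by
  have hAF := Finset.subset_inter h h'
  obtain ⟨a, ha⟩ := hA.1
  have hJ : IsJunction G (F ∩ F') := ⟨⟨a, hAF ha⟩, F, F', hF, hF', hne, rfl⟩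
  exact (hJ.subset_of_mem_of_mem hA hG (hAF ha) ha).antisymm hAF

theorem IsJunction.mem_of_walk [Finite V] (hA : IsJunction G A) (hG : IsGeneralizedBlockGraph G)
    (hF : IsMaxClique G F) (hAF : A ⊆ F) (ha : a ∈ A) {u w : V} (p : G.Walk u w)
    (hp : ∀ x ∈ p.support, x ∉ A ∧ G.Adj a x) (hu : u ∈ F) : w ∈ F := by
  induction p with
  | nil => exact hu
  | @cons u v w huv p ih =>
    rw [SimpleGraph.Walk.support_cons, List.forall_mem_cons] at hp
    obtain ⟨⟨huA, hau⟩, hp⟩ := hp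
    have hclique : G.IsClique (({a, u, v} : Finset V) : Set V) := by
      simp [SimpleGraph.isClique_insert, hau, huv, (hp v p.start_mem_support).2]
    obtain ⟨E, hsub, hE⟩ := exists_isMaxClique_of_isClique hclique
    have hAE : A ⊆ E := hA.subset_of_mem hG hE ha (hsub (by simp))
    obtain rfl : E = F := by
      by_contra hne
      rw [← hA.inter_eq hG hE hF hne hAE hAF] at huA
      exact huA (Finset.mem_inter.2 ⟨hsub (by simp), hu⟩)
    exact ih hp (hsub (by simp))

theorem IsJunction.not_reachable [Finite V] (hA : IsJunction G A)
    (hG : IsGeneralizedBlockGraph G) (hF : IsMaxClique G F) (hF' : IsMaxClique G F')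
    (hne : F ≠ F') (hAF : A ⊆ F) (hAF' : A ⊆ F') {u w : V} (hu : u ∈ F) (hw : w ∈ F')
    (huA : u ∉ A) : ¬ (deleteVerts G A).Reachable u w := by
  intro h
  obtain ⟨q, hq⟩ := exists_walk_of_reachable_deleteVerts h huA
  have hwA : w ∉ A := hq w q.end_mem_support
  obtain ⟨a, ha⟩ := hA.1
  have hadj {x : V} (hx : x ∉ A) {E : Finset V} (hE : IsMaxClique G E) (hAE : A ⊆ E)
      (hxE : x ∈ E) : G.Adj a x :=
    hE.adj (hAE ha) hxE (by rintro rfl; exact hx ha)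
  obtain ⟨p, hpq, hp⟩ := hG.1.exists_walk_neighbors q (fun h => hq a h ha)
    (hadj huA hF hAF hu) (hadj hwA hF' hAF' hw)
  have hwF := hA.mem_of_walk hG hF hAF ha p (fun x hx => ⟨hq x (hpq hx), hp x hx⟩) hu
  exact hwA (hA.inter_eq hG hF hF' hne hAF hAF' ▸ Finset.mem_inter.2 ⟨hwF, hw⟩)

end Junctions

section Counting

variable {V : Type*} {G : SimpleGraph V}

section Components

variable {S T A : Set V} {a x y : V}

theorem ncard_image_connectedComponentMk_eq (hST : S ⊆ T) {U : Set V}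
    (h : ∀ x ∈ U, ∀ y ∈ U, (deleteVerts G S).Reachable x y → (deleteVerts G T).Reachable x y) :
    ((deleteVerts G T).connectedComponentMk '' U).ncard =
      ((deleteVerts G S).connectedComponentMk '' U).ncard := by
  let φ := SimpleGraph.ConnectedComponent.map
    (SimpleGraph.Hom.ofLE (deleteVerts_mono (le_refl G) hST))
  have himage : (deleteVerts G S).connectedComponentMk '' U =
      φ '' ((deleteVerts G T).connectedComponentMk '' U) := by
    rw [Set.image_image]
    rfl
  rw [himage]
  refine (Set.InjOn.ncard_image ?_).symm
  rintro _ ⟨x, hx, rfl⟩ _ ⟨y, hy, rfl⟩ hxy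
  exact SimpleGraph.ConnectedComponent.sound
    (h x hx y hy (SimpleGraph.ConnectedComponent.exact hxy))

theorem reachable_or_reachable_union (hA : G.IsClique A) (hd : Disjoint S A) (ha : a ∈ A)
    (h : (deleteVerts G S).Reachable x y) :
    (deleteVerts G S).Reachable x a ∨ (deleteVerts G (S ∪ A)).Reachable x y := by
  have hreach {b : V} (hb : b ∈ A) : (deleteVerts G S).Reachable b a :=
    reachable_of_isClique hA hb ha (hd.notMem_of_mem_right hb) (hd.notMem_of_mem_right ha)
  obtain ⟨p⟩ := h
  induction p with
  | nil => exact Or.inr .rfl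
  | @cons x z y hxz _ ih =>
    by_cases hx : x ∈ A
    · exact Or.inl (hreach hx)
    by_cases hz : z ∈ A
    · exact Or.inl (hxz.reachable.trans (hreach hz))
    have hxz' : (deleteVerts G (S ∪ A)).Adj x z :=
      ⟨hxz.1, by simp [hx, hxz.2.1], by simp [hz, hxz.2.2]⟩
    exact ih.imp hxz.reachable.trans hxz'.reachable.trans

theorem exists_reachable_union_adj (h : (deleteVerts G S).Reachable x a) (ha : a ∈ A)
    (hx : x ∉ A) :
    ∃ w b, w ∉ S ∪ A ∧ b ∈ A ∧ G.Adj w b ∧ (deleteVerts G (S ∪ A)).Reachable x w := by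
  obtain ⟨p⟩ := h
  induction p with
  | nil => exact absurd ha hx
  | @cons x z a hxz _ ih =>
    have hxSA : x ∉ S ∪ A := by simp [hx, hxz.2.1]
    by_cases hz : z ∈ A
    · exact ⟨x, z, hxSA, hz, hxz.1, .rfl⟩
    · obtain ⟨w, b, hw, hb, hwb, hzw⟩ := ih ha hz
      have hxz' : (deleteVerts G (S ∪ A)).Adj x z := ⟨hxz.1, hxSA, by simp [hz, hxz.2.2]⟩
      exact ⟨w, b, hw, hb, hwb, hxz'.reachable.trans hzw⟩

variable [Finite V]

theorem numComp_eq_ncard_add_one (ha : a ∉ S) :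
    numComp G S = ((deleteVerts G S).connectedComponentMk ''
      {x | x ∉ S ∧ ¬ (deleteVerts G S).Reachable x a}).ncard + 1 := by
  rw [numComp, ← Set.ncard_insert_of_notMem (a := (deleteVerts G S).connectedComponentMk a)]
  · congr 1
    ext C
    constructor
    · rintro ⟨x, hx, rfl⟩
      by_cases hxa : (deleteVerts G S).Reachable x a
      · exact Or.inl (SimpleGraph.ConnectedComponent.sound hxa)
      · exact Or.inr ⟨x, ⟨hx, hxa⟩, rfl⟩
    · rintro (rfl | ⟨x, hx, rfl⟩)
      exacts [⟨a, ha, rfl⟩, ⟨x, hx.1, rfl⟩]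
  · rintro ⟨x, hx, hxa⟩
    exact hx.2 (SimpleGraph.ConnectedComponent.exact hxa)

theorem numComp_eq_ncard_add_ncard (hST : S ⊆ T) (a : V) :
    numComp G T =
      ((deleteVerts G T).connectedComponentMk ''
        {x | x ∉ T ∧ (deleteVerts G S).Reachable x a}).ncard +
      ((deleteVerts G T).connectedComponentMk ''
        {x | x ∉ T ∧ ¬ (deleteVerts G S).Reachable x a}).ncard := by
  rw [← Set.ncard_union_eq, ← Set.image_union, numComp]
  · congr 2
    ext x
    simp only [Set.mem_compl_iff, Set.mem_union, Set.mem_ofPred_eq]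
    tauto
  · rw [Set.disjoint_left]
    rintro _ ⟨x, hx, rfl⟩ ⟨y, hy, hyx⟩
    exact hy.2 (((SimpleGraph.ConnectedComponent.exact hyx).mono
      (deleteVerts_mono le_rfl hST)).trans hx.2)

theorem numComp_union_of_isClique (hA : G.IsClique A) (hd : Disjoint S A) (ha : a ∈ A) :
    numComp G (S ∪ A) + 1 = numComp G S +
      ((deleteVerts G (S ∪ A)).connectedComponentMk ''
        {x | x ∉ S ∪ A ∧ (deleteVerts G S).Reachable x a}).ncard := by
  have haS : a ∉ S := hd.notMem_of_mem_right ha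
  have hfar : {x | x ∉ S ∪ A ∧ ¬ (deleteVerts G S).Reachable x a} =
      {x | x ∉ S ∧ ¬ (deleteVerts G S).Reachable x a} := by
    ext x
    refine and_congr_left fun hxa => not_congr (or_iff_left fun hxA => hxa ?_)
    exact reachable_of_isClique hA hxA ha (hd.notMem_of_mem_right hxA) haS
  have hcard := ncard_image_connectedComponentMk_eq (G := G) (T := S ∪ A)
    (U := {x | x ∉ S ∧ ¬ (deleteVerts G S).Reachable x a}) Set.subset_union_left
    fun x hx y _ hxy => (reachable_or_reachable_union hA hd ha hxy).resolve_left hx.2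
  rw [numComp_eq_ncard_add_ncard Set.subset_union_left a, numComp_eq_ncard_add_one haS, hfar,
    hcard]
  ring

end Components

variable [DecidableEq V]

theorem card_sup_eq_sum (hG : IsGeneralizedBlockGraph G) {𝒮 : Finset (Finset V)}
    (h𝒮 : ∀ A ∈ 𝒮, IsJunction G A) : (𝒮.sup id).card = ∑ A ∈ 𝒮, A.card := by
  rw [Finset.sup_eq_biUnion]
  exact Finset.card_biUnion fun A hA B hB => (h𝒮 A hA).disjoint (h𝒮 B hB) hG

variable [Fintype V] {A S : Finset V}

open Classical in
/-- The maximal cliques that contain `A`. -/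
noncomputable def cliquesOver (G : SimpleGraph V) (A : Finset V) : Finset (Finset V) :=
  {F | IsMaxClique G F ∧ A ⊆ F}

open Classical in
/-- The maximal cliques contained in `S`. -/
noncomputable def cliquesIn (G : SimpleGraph V) (S : Finset V) : Finset (Finset V) :=
  {F | IsMaxClique G F ∧ F ⊆ S}

@[simp] theorem mem_cliquesOver {F : Finset V} :
    F ∈ cliquesOver G A ↔ IsMaxClique G F ∧ A ⊆ F := by simp [cliquesOver]

@[simp] theorem mem_cliquesIn {F : Finset V} :
    F ∈ cliquesIn G S ↔ IsMaxClique G F ∧ F ⊆ S := by simp [cliquesIn]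

theorem IsJunction.two_le_card_cliquesOver (hA : IsJunction G A) :
    2 ≤ (cliquesOver G A).card := by
  obtain ⟨-, F₁, F₂, hF₁, hF₂, hne, rfl⟩ := hA
  exact Finset.one_lt_card.2 ⟨F₁, by simp [hF₁], F₂, by simp [hF₂], hne⟩

theorem IsJunction.cliquesIn_eq_empty (hA : IsJunction G A) : cliquesIn G A = ∅ :=
  Finset.eq_empty_of_forall_notMem fun _ hF =>
    hA.not_subset (mem_cliquesIn.1 hF).1 (mem_cliquesIn.1 hF).2

theorem cliquesIn_empty [Nonempty V] (G : SimpleGraph V) : cliquesIn G ∅ = ∅ := by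
  refine Finset.eq_empty_of_forall_notMem fun F hF => ?_
  obtain ⟨hF, hF0⟩ := mem_cliquesIn.1 hF
  obtain ⟨v⟩ := ‹Nonempty V›
  obtain ⟨F', hF', hv⟩ := exists_isMaxClique_of_mem G v
  obtain rfl := hF.eq_of_subset hF' (hF0.trans (Finset.empty_subset _))
  exact Finset.notMem_empty v (hF0 hv)

theorem IsJunction.ncard_components_touching (hA : IsJunction G A)
    (hG : IsGeneralizedBlockGraph G) (hd : Disjoint S A) {a : V} (ha : a ∈ A) :
    ((deleteVerts G (S ∪ A)).connectedComponentMk ''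
        {x | x ∉ (S ∪ A : Set V) ∧ (deleteVerts G S).Reachable x a}).ncard =
      ((cliquesOver G A).filter fun F => ¬ F ⊆ S ∪ A).card := by
  have hleave : ∀ F ∈ (cliquesOver G A).filter fun F => ¬ F ⊆ S ∪ A,
      ∃ v, v ∈ F ∧ v ∉ (S ∪ A : Set V) := fun F hF => by
    simpa using Finset.not_subset.1 (Finset.mem_filter.1 hF).2
  have : Nonempty V := ⟨a⟩
  choose! v hvF hv using hleave
  rw [← Set.ncard_coe_finset, ← Set.InjOn.ncard_image
    (f := fun F => (deleteVerts G (S ∪ A)).connectedComponentMk (v F))]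
  · congr 1
    refine Set.Subset.antisymm ?_ ?_
    · rintro _ ⟨x, ⟨hx, hxa⟩, rfl⟩
      obtain ⟨w, b, hw, hb, hwb, hxw⟩ := exists_reachable_union_adj hxa ha fun h => hx (Or.inr h)
      obtain ⟨F, hF, hwF, hbF⟩ := exists_isMaxClique_of_adj hwb
      have hmem : F ∈ (cliquesOver G A).filter fun F => ¬ F ⊆ S ∪ A :=
        Finset.mem_filter.2 ⟨mem_cliquesOver.2 ⟨hF, hA.subset_of_mem hG hF hb hbF⟩,
          fun h => hw (by simpa using h hwF)⟩
      exact ⟨F, hmem, SimpleGraph.ConnectedComponent.sound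
        ((reachable_of_isClique hF.prop (hvF F hmem) hwF (hv F hmem) hw).trans hxw.symm)⟩
    · rintro _ ⟨F, hF, rfl⟩
      obtain ⟨hFmax, hAF⟩ := mem_cliquesOver.1 (Finset.mem_filter.1 hF).1
      exact ⟨v F, ⟨hv F hF, reachable_of_isClique hFmax.prop (hvF F hF) (hAF ha)
        (fun h => hv F hF (Or.inl h)) (Finset.disjoint_right.1 hd ha)⟩, rfl⟩
  · intro F hF F' hF' heq
    obtain ⟨hFmax, hAF⟩ := mem_cliquesOver.1 (Finset.mem_filter.1 hF).1
    obtain ⟨hF'max, hAF'⟩ := mem_cliquesOver.1 (Finset.mem_filter.1 hF').1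
    by_contra hne
    exact hA.not_reachable hG hFmax hF'max hne hAF hAF' (hvF F hF) (hvF F' hF')
      (fun h => hv F hF (Or.inr h)) ((SimpleGraph.ConnectedComponent.exact heq).mono
        (deleteVerts_mono le_rfl Set.subset_union_right))

theorem IsJunction.numComp_union (hA : IsJunction G A) (hG : IsGeneralizedBlockGraph G)
    (hd : Disjoint S A) :
    numComp G (S ∪ A) + 1 =
      numComp G S + ((cliquesOver G A).filter fun F => ¬ F ⊆ S ∪ A).card := by
  obtain ⟨a, ha⟩ := hA.1
  rw [numComp_union_of_isClique hA.isClique (Finset.disjoint_coe.2 hd) ha,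
    hA.ncard_components_touching hG hd ha]

theorem IsJunction.card_cliquesIn_union (hA : IsJunction G A) (hG : IsGeneralizedBlockGraph G)
    (hd : Disjoint S A) :
    (cliquesIn G (S ∪ A)).card =
      (cliquesIn G S).card + ((cliquesOver G A).filter fun F => F ⊆ S ∪ A).card := by
  rw [← Finset.card_union_of_disjoint]
  · congr 1
    ext F
    simp only [mem_cliquesIn, Finset.mem_union, Finset.mem_filter, mem_cliquesOver]
    refine ⟨fun ⟨hF, hFS⟩ => ?_, ?_⟩
    · by_cases hdF : Disjoint F A
      · exact Or.inl ⟨hF, hdF.left_le_of_le_sup_right hFS⟩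
      · obtain ⟨a, haF, ha⟩ := Finset.not_disjoint_iff.1 hdF
        exact Or.inr ⟨⟨hF, hA.subset_of_mem hG hF ha haF⟩, hFS⟩
    · rintro (⟨hF, hFS⟩ | ⟨⟨hF, -⟩, hFS⟩)
      exacts [⟨hF, hFS.trans Finset.subset_union_left⟩, ⟨hF, hFS⟩]
  · obtain ⟨a, ha⟩ := hA.1
    rw [Finset.disjoint_left]
    intro F hFS hF
    have hAF := (mem_cliquesOver.1 (Finset.mem_filter.1 hF).1).2
    exact Finset.disjoint_right.1 hd ha ((mem_cliquesIn.1 hFS).2 (hAF ha))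

theorem numComp_sup (hconn : G.Connected) (hG : IsGeneralizedBlockGraph G)
    {𝒮 : Finset (Finset V)} (h𝒮 : ∀ A ∈ 𝒮, IsJunction G A) :
    numComp G (𝒮.sup id : Finset V) + (cliquesIn G (𝒮.sup id)).card + 𝒮.card =
      1 + ∑ A ∈ 𝒮, (cliquesOver G A).card := by
  induction 𝒮 using Finset.induction_on with
  | empty =>
    have := hconn.nonempty
    simp [numComp_empty hconn, cliquesIn_empty]
  | insert A 𝒮 hnot ih =>
    obtain ⟨hA, h𝒮⟩ := (Finset.forall_mem_insert _ _ _).1 h𝒮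
    have hd : Disjoint (𝒮.sup id) A := Finset.disjoint_sup_left.2 fun B hB =>
      (h𝒮 B hB).disjoint hA hG (by rintro rfl; exact hnot hB)
    have hsup : (insert A 𝒮).sup id = 𝒮.sup id ∪ A := by
      rw [Finset.sup_insert, sup_comm]
      rfl
    have hcomp := hA.numComp_union hG hd
    have hcliques := Finset.card_filter_add_card_filter_not (s := cliquesOver G A)
      (fun F => F ⊆ 𝒮.sup id ∪ A)
    rw [hsup, Finset.sum_insert hnot, Finset.card_insert_of_notMem hnot,
      hA.card_cliquesIn_union hG hd, Finset.coe_union]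
    have := ih h𝒮
    omega

theorem numComp_sup_of_card (hconn : G.Connected) (hG : IsGeneralizedBlockGraph G)
    (hcard : ∀ A, IsJunction G A → (cliquesOver G A).card = A.card + 1)
    {𝒮 : Finset (Finset V)} (h𝒮 : ∀ A ∈ 𝒮, IsJunction G A) :
    numComp G (𝒮.sup id : Finset V) + (cliquesIn G (𝒮.sup id)).card = (𝒮.sup id).card + 1 := by
  have hcomp := numComp_sup hconn hG h𝒮
  rw [Finset.sum_congr rfl fun A hA => hcard A (h𝒮 A hA), Finset.sum_add_distrib,
    ← card_sup_eq_sum hG h𝒮, Finset.sum_const, smul_eq_mul, mul_one] at hcomp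
  omega

theorem IsJunction.numComp_eq (hA : IsJunction G A) (hconn : G.Connected)
    (hG : IsGeneralizedBlockGraph G) : numComp G A = (cliquesOver G A).card := by
  have h := numComp_sup hconn hG (𝒮 := {A}) (by simpa using hA)
  rw [Finset.sup_singleton, id, Finset.sum_singleton, Finset.card_singleton,
    hA.cliquesIn_eq_empty, Finset.card_empty] at h
  omega

end Counting

section CutSets

variable {V : Type*} {G : SimpleGraph V}

theorem card_connectedComponent_induce_compl (G : SimpleGraph V) (S : Set V) :
    Nat.card (G.induce Sᶜ).ConnectedComponent = numComp G S := by
  let φ : G.induce Sᶜ →g deleteVerts G S := ⟨Subtype.val, fun {x y} h => ⟨h, x.2, y.2⟩⟩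
  have hinj : Function.Injective (SimpleGraph.ConnectedComponent.map φ) := by
    rintro ⟨x⟩ ⟨y⟩ hxy
    obtain ⟨p, hp⟩ := exists_walk_of_reachable_deleteVerts
      (SimpleGraph.ConnectedComponent.exact hxy) x.2
    exact SimpleGraph.ConnectedComponent.sound ⟨p.induce _ hp⟩
  have hrange : Set.range (SimpleGraph.ConnectedComponent.map φ) =
      (deleteVerts G S).connectedComponentMk '' Sᶜ := by
    ext C
    constructor
    · rintro ⟨⟨x⟩, rfl⟩
      exact ⟨x, x.2, rfl⟩
    · rintro ⟨x, hx, rfl⟩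
      exact ⟨(G.induce Sᶜ).connectedComponentMk ⟨x, hx⟩, rfl⟩
  rw [numComp, ← hrange, Set.ncard_range_of_injective hinj]

theorem isCutSet_iff (hconn : G.Connected) {A : Finset V} :
    IsCutSet G A ↔ 1 < numComp G A := by
  have := hconn.preconnected.subsingleton_connectedComponent
  rw [IsCutSet, card_connectedComponent_induce_compl,
    Nat.card_of_subsingleton (G.connectedComponentMk hconn.nonempty.some)]

variable [Finite V] [DecidableEq V] {A S : Finset V}

theorem reachable_deleteVerts_of_walk (hS : ∀ A, IsJunction G A → ¬ A ⊆ S) {v w : V}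
    (p : G.Walk v w) (hw : w ∉ S) {F : Finset V} (hF : IsMaxClique G F) (hv : v ∈ F) {u : V}
    (hu : u ∈ F) (huS : u ∉ S) : (deleteVerts G S).Reachable u w := by
  induction p generalizing F u with
  | nil => exact reachable_of_isClique hF.prop hu hv huS hw
  | @cons v v' w h _ ih =>
    obtain ⟨F', hF', hvF', hv'F'⟩ := exists_isMaxClique_of_adj h
    rcases eq_or_ne F F' with rfl | hne
    · exact ih hw hF hv'F' hu huS
    · obtain ⟨a, ha, haS⟩ := Finset.not_subset.1 (hS (F ∩ F')
        ⟨⟨v, Finset.mem_inter.2 ⟨hv, hvF'⟩⟩, F, F', hF, hF', hne, rfl⟩)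
      rw [Finset.mem_inter] at ha
      exact (reachable_of_isClique hF.prop hu ha.1 huS haS).trans (ih hw hF' hv'F' ha.2 haS)

theorem IsCutSet.exists_isJunction (hS : IsCutSet G S) (hconn : G.Connected) :
    ∃ A, IsJunction G A ∧ A ⊆ S := by
  by_contra! hnone
  rw [isCutSet_iff hconn, numComp, Set.one_lt_ncard] at hS
  obtain ⟨_, ⟨x, hx, rfl⟩, _, ⟨y, hy, rfl⟩, hxy⟩ := hS
  obtain ⟨F, hF, hxF⟩ := exists_isMaxClique_of_mem G x
  obtain ⟨p⟩ := hconn.preconnected x y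
  exact hxy (SimpleGraph.ConnectedComponent.sound
    (reachable_deleteVerts_of_walk hnone p hy hF hxF hxF hx))

theorem IsJunction.isCutSet (hA : IsJunction G A) (hconn : G.Connected)
    (hG : IsGeneralizedBlockGraph G) : IsCutSet G A := by
  cases nonempty_fintype V
  rw [isCutSet_iff hconn, hA.numComp_eq hconn hG]
  exact hA.two_le_card_cliquesOver

theorem isMinimalCutSet_iff (hconn : G.Connected) (hG : IsGeneralizedBlockGraph G) :
    IsMinimalCutSet G A ↔ IsJunction G A := by
  constructor
  · intro hA
    obtain ⟨B, hB, hBA⟩ := IsCutSet.exists_isJunction hA.prop hconn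
    exact hA.eq_of_le (hB.isCutSet hconn hG) hBA ▸ hB
  · refine fun hA => ⟨hA.isCutSet hconn hG, fun B hB hBA => ?_⟩
    obtain ⟨C, hC, hCB⟩ := IsCutSet.exists_isJunction hB hconn
    obtain ⟨c, hc⟩ := hC.1
    exact (hA.subset_of_mem_of_mem hC hG (hBA (hCB hc)) hc).trans hCB

theorem IsJunction.exists_not_reachable (hA : IsJunction G A) (hG : IsGeneralizedBlockGraph G)
    (hAS : A ⊆ S) {F₁ F₂ : Finset V} (hF₁ : IsMaxClique G F₁) (hF₂ : IsMaxClique G F₂)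
    (hne : F₁ ≠ F₂) (hAF₁ : A ⊆ F₁) (hAF₂ : A ⊆ F₂) (hF₁S : ¬ F₁ ⊆ S) (hF₂S : ¬ F₂ ⊆ S) {v : V}
    (hv : v ∈ A) :
    ∃ a b, a ∉ S ∧ b ∉ S ∧ G.Adj v a ∧ G.Adj v b ∧ ¬ (deleteVerts G S).Reachable a b := by
  obtain ⟨a, ha, haS⟩ := Finset.not_subset.1 hF₁S
  obtain ⟨b, hb, hbS⟩ := Finset.not_subset.1 hF₂S
  refine ⟨a, b, haS, hbS, hF₁.adj (hAF₁ hv) ha ?_, hF₂.adj (hAF₂ hv) hb ?_, fun hab => ?_⟩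
  · rintro rfl
    exact haS (hAS hv)
  · rintro rfl
    exact hbS (hAS hv)
  · exact hA.not_reachable hG hF₁ hF₂ hne hAF₁ hAF₂ ha hb (fun h => haS (hAS h))
      (hab.mono (deleteVerts_mono le_rfl (Finset.coe_subset.2 hAS)))

theorem IsJunction.hasCutProperty (hA : IsJunction G A) (hG : IsGeneralizedBlockGraph G) :
    HasCutProperty G A := by
  obtain ⟨-, F₁, F₂, hF₁, hF₂, hne, hA'⟩ := id hA
  exact fun v hv => hA.exists_not_reachable hG subset_rfl hF₁ hF₂ hne
    (hA' ▸ Finset.inter_subset_left) (hA' ▸ Finset.inter_subset_right) (hA.not_subset hF₁)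
    (hA.not_subset hF₂) hv

theorem HasCutProperty.exists_isMaxClique (hS : HasCutProperty G S) {v : V} (hv : v ∈ S) :
    ∃ F₁ F₂, IsMaxClique G F₁ ∧ IsMaxClique G F₂ ∧ F₁ ≠ F₂ ∧ v ∈ F₁ ∧ v ∈ F₂ ∧
      ¬ F₁ ⊆ S ∧ ¬ F₂ ⊆ S ∧ F₁ ∩ F₂ ⊆ S := by
  obtain ⟨a, b, ha, hb, hva, hvb, hab⟩ := hS v hv
  obtain ⟨F₁, hF₁, hv₁, ha₁⟩ := exists_isMaxClique_of_adj hva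
  obtain ⟨F₂, hF₂, hv₂, hb₂⟩ := exists_isMaxClique_of_adj hvb
  refine ⟨F₁, F₂, hF₁, hF₂, ?_, hv₁, hv₂, fun h => ha (h ha₁), fun h => hb (h hb₂), fun w hw => ?_⟩
  · rintro rfl
    exact hab (reachable_of_isClique hF₁.prop ha₁ hb₂ ha hb)
  · by_contra hwS
    rw [Finset.mem_inter] at hw
    exact hab ((reachable_of_isClique hF₁.prop ha₁ hw.1 ha hwS).trans
      (reachable_of_isClique hF₂.prop hw.2 hb₂ hwS hb))

theorem HasCutProperty.exists_isJunction (hS : HasCutProperty G S) {v : V} (hv : v ∈ S) :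
    ∃ A, IsJunction G A ∧ A ⊆ S ∧ v ∈ A := by
  obtain ⟨F₁, F₂, hF₁, hF₂, hne, hv₁, hv₂, -, -, hsub⟩ := hS.exists_isMaxClique hv
  have hv₁₂ := Finset.mem_inter.2 ⟨hv₁, hv₂⟩
  exact ⟨F₁ ∩ F₂, ⟨⟨v, hv₁₂⟩, F₁, F₂, hF₁, hF₂, hne, rfl⟩, hsub, hv₁₂⟩

end CutSets

section Unmixed

variable {V : Type*} [Fintype V] [DecidableEq V] {G : SimpleGraph V} {A S : Finset V}

theorem IsJunction.inf_cliquesOver (hA : IsJunction G A) : (cliquesOver G A).inf id = A := by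
  refine le_antisymm ?_ (Finset.le_inf fun F hF => (mem_cliquesOver.1 hF).2)
  obtain ⟨-, F₁, F₂, hF₁, hF₂, -, rfl⟩ := hA
  exact Finset.subset_inter
    (Finset.inf_le (f := id) (mem_cliquesOver.2 ⟨hF₁, Finset.inter_subset_left⟩))
    (Finset.inf_le (f := id) (mem_cliquesOver.2 ⟨hF₂, Finset.inter_subset_right⟩))

theorem isTMinimalCutSet_iff (hconn : G.Connected) (hG : IsGeneralizedBlockGraph G) {t : ℕ} :
    IsTMinimalCutSet G t A ↔ IsJunction G A ∧ t = (cliquesOver G A).card := by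
  rw [IsTMinimalCutSet, isMinimalCutSet_iff hconn hG]
  refine and_congr_right fun hA => ⟨?_, ?_⟩
  · rintro ⟨𝓕, rfl, hmax, hinf, hdisj⟩
    obtain ⟨a, ha⟩ := hA.1
    congr 1
    ext F
    rw [mem_cliquesOver]
    refine ⟨fun hF => ⟨hmax F hF, hinf ▸ Finset.inf_le (f := id) hF⟩, fun ⟨hF, hAF⟩ => ?_⟩
    by_contra hnot
    exact Finset.disjoint_left.1 (hdisj F hF hnot) (hAF ha) ha
  · rintro rfl
    refine ⟨cliquesOver G A, rfl, fun F hF => (mem_cliquesOver.1 hF).1, hA.inf_cliquesOver,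
      fun F hF hnot => Finset.disjoint_right.2 fun b hb hbF => hnot ?_⟩
    exact mem_cliquesOver.2 ⟨hF, hA.subset_of_mem hG hF hb hbF⟩

theorem hasCutProperty_sup (hG : IsGeneralizedBlockGraph G) {𝒮 : Finset (Finset V)}
    (h𝒮 : ∀ A ∈ 𝒮, IsJunction G A)
    (hcard : ∀ A ∈ 𝒮, 2 ≤ ((cliquesOver G A).filter fun F => ¬ F ⊆ 𝒮.sup id).card) :
    HasCutProperty G (𝒮.sup id : Finset V) := by
  intro v hv
  obtain ⟨A, hA, hvA⟩ := Finset.mem_sup.1 hv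
  obtain ⟨F₁, hF₁, F₂, hF₂, hne⟩ := Finset.one_lt_card.1 (hcard A hA)
  simp only [Finset.mem_filter, mem_cliquesOver] at hF₁ hF₂
  exact (h𝒮 A hA).exists_not_reachable hG (Finset.le_sup (f := id) hA) hF₁.1.1 hF₂.1.1 hne
    hF₁.1.2 hF₂.1.2 hF₁.2 hF₂.2 hvA

theorem card_filter_not_subset_of_isMaxClique {F : Finset V} (hF : IsMaxClique G F) (hAF : A ⊆ F) :
    ((cliquesOver G A).filter fun F' => ¬ F' ⊆ F).card + 1 = (cliquesOver G A).card := by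
  rw [← Finset.card_erase_add_one (mem_cliquesOver.2 ⟨hF, hAF⟩)]
  congr 2
  ext F'
  rw [Finset.mem_erase, Finset.mem_filter, and_comm]
  refine and_congr_left fun hF' => not_congr ⟨(mem_cliquesOver.1 hF').1.eq_of_subset hF, ?_⟩
  rintro rfl
  rfl

theorem IsJunction.card_cliquesOver_of_forall_numComp (hA : IsJunction G A) (hconn : G.Connected)
    (hG : IsGeneralizedBlockGraph G)
    (h : ∀ S : Set V, HasCutProperty G S → numComp G S = S.ncard + 1) :
    (cliquesOver G A).card = A.card + 1 := by
  rw [← hA.numComp_eq hconn hG, h _ (hA.hasCutProperty hG), Set.ncard_coe_finset]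

open Classical in
/-- The junctions contained in `S`. -/
noncomputable def junctionsIn (G : SimpleGraph V) (S : Finset V) : Finset (Finset V) :=
  {A | IsJunction G A ∧ A ⊆ S}

theorem mem_junctionsIn : A ∈ junctionsIn G S ↔ IsJunction G A ∧ A ⊆ S := by simp [junctionsIn]

theorem sup_junctionsIn (h : ∀ v ∈ S, ∃ A, IsJunction G A ∧ A ⊆ S ∧ v ∈ A) :
    (junctionsIn G S).sup id = S := by
  refine le_antisymm (Finset.sup_le fun A hA => (mem_junctionsIn.1 hA).2) fun v hv => ?_
  obtain ⟨A, hA, hAS, hvA⟩ := h v hv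
  exact Finset.mem_sup.2 ⟨A, mem_junctionsIn.2 ⟨hA, hAS⟩, hvA⟩

theorem HasCutProperty.sup_junctionsIn_of_isMaxClique (hS : HasCutProperty G S)
    (hG : IsGeneralizedBlockGraph G) {F : Finset V} (hF : IsMaxClique G F) (hFS : F ⊆ S) :
    (junctionsIn G F).sup id = F := by
  refine sup_junctionsIn fun v hv => ?_
  obtain ⟨A, hA, -, hvA⟩ := hS.exists_isJunction (hFS hv)
  exact ⟨A, hA, hA.subset_of_mem hG hF hvA hv, hvA⟩

theorem HasCutProperty.three_le_card_cliquesOver (hS : HasCutProperty G S)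
    (hG : IsGeneralizedBlockGraph G) {F : Finset V} (hF : IsMaxClique G F) (hFS : F ⊆ S)
    (hA : IsJunction G A) (hAF : A ⊆ F) : 3 ≤ (cliquesOver G A).card := by
  obtain ⟨v, hv⟩ := hA.1
  obtain ⟨F₁, F₂, hF₁, hF₂, hne, hv₁, hv₂, hF₁S, hF₂S, -⟩ := hS.exists_isMaxClique (hFS (hAF hv))
  refine Finset.two_lt_card.2 ⟨F, mem_cliquesOver.2 ⟨hF, hAF⟩,
    F₁, mem_cliquesOver.2 ⟨hF₁, hA.subset_of_mem hG hF₁ hv hv₁⟩,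
    F₂, mem_cliquesOver.2 ⟨hF₂, hA.subset_of_mem hG hF₂ hv hv₂⟩, ?_, ?_, hne⟩
  · rintro rfl
    exact hF₁S hFS
  · rintro rfl
    exact hF₂S hFS

theorem HasCutProperty.numComp_eq (hS : HasCutProperty G S) (hconn : G.Connected)
    (hG : IsGeneralizedBlockGraph G)
    (hcard : ∀ A, IsJunction G A → (cliquesOver G A).card = A.card + 1)
    (hone : ∀ 𝒮 : Finset (Finset V), (∀ A ∈ 𝒮, IsJunction G A) → IsMaxClique G (𝒮.sup id) →
      ∃ A ∈ 𝒮, A.card = 1) :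
    numComp G S = S.card + 1 := by
  have hjunction (T : Finset V) : ∀ A ∈ junctionsIn G T, IsJunction G A :=
    fun A hA => (mem_junctionsIn.1 hA).1
  have hempty : cliquesIn G S = ∅ := by
    refine Finset.eq_empty_of_forall_notMem fun F hFS => ?_
    obtain ⟨hF, hFS⟩ := mem_cliquesIn.1 hFS
    have hsup := hS.sup_junctionsIn_of_isMaxClique hG hF hFS
    obtain ⟨A, hA, hA1⟩ := hone _ (hjunction F) (by rwa [hsup])
    obtain ⟨hA, hAF⟩ := mem_junctionsIn.1 hA
    have hthree := hS.three_le_card_cliquesOver hG hF hFS hA hAF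
    rw [hcard A hA, hA1] at hthree
    omega
  have hcount := numComp_sup_of_card hconn hG hcard (hjunction S)
  rwa [sup_junctionsIn fun v hv => hS.exists_isJunction hv, hempty, Finset.card_empty,
    add_zero] at hcount

end Unmixed

theorem exists_card_eq_one_of_forall_numComp {V : Type*} [Finite V] [DecidableEq V]
    {G : SimpleGraph V} (hconn : G.Connected)
    (hG : IsGeneralizedBlockGraph G)
    (h : ∀ S : Set V, HasCutProperty G S → numComp G S = S.ncard + 1) {𝒮 : Finset (Finset V)}
    (h𝒮 : ∀ A ∈ 𝒮, IsJunction G A) (hF : IsMaxClique G (𝒮.sup id)) : ∃ A ∈ 𝒮, A.card = 1 := by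
  cases nonempty_fintype V
  have hcard (A) (hA : IsJunction G A) := hA.card_cliquesOver_of_forall_numComp hconn hG h
  by_contra! hone
  have hcut : HasCutProperty G (𝒮.sup id : Finset V) := hasCutProperty_sup hG h𝒮 fun A hA => by
    have hleave := card_filter_not_subset_of_isMaxClique hF (Finset.le_sup (f := id) hA)
    have hover := hcard A (h𝒮 A hA)
    have hpos := Finset.card_pos.2 (h𝒮 A hA).1
    have hneone := hone A hA
    simp only [id] at hleave
    omega
  have hcount := numComp_sup_of_card hconn hG hcard h𝒮
  have hcomp := h _ hcut
  have hpos := Finset.card_pos.2 ⟨_, mem_cliquesIn.2 ⟨hF, subset_rfl⟩⟩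
  rw [Set.ncard_coe_finset] at hcomp
  omega

end GenBlock

theorem theorem3p3 {K : Type*} [Field K] {V : Type*} [Fintype V] [DecidableEq V]
    (G : SimpleGraph V) (hconn : G.Connected) (hG : GenBlock.IsGeneralizedBlockGraph G) :
    GenBlock.IsUnmixed (GenBlock.binomialEdgeIdeal K G) ↔
      (∀ (t : ℕ) (A : Finset V), GenBlock.IsTMinimalCutSet G t A → (A.card : ℤ) = (t : ℤ) - 1) ∧
      (∀ 𝒜 : Finset (Finset V), (∀ A ∈ 𝒜, GenBlock.IsMinimalCutSet G A) →
        GenBlock.IsMaxClique G (𝒜.sup id) → ∃ A ∈ 𝒜, A.card = 1) := by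
  rw [GenBlock.isUnmixed_binomialEdgeIdeal_iff K hconn]
  simp only [GenBlock.isTMinimalCutSet_iff hconn hG, GenBlock.isMinimalCutSet_iff hconn hG]
  constructor
  · refine fun h => ⟨?_, fun 𝒜 => GenBlock.exists_card_eq_one_of_forall_numComp hconn hG h⟩
    rintro t A ⟨hA, rfl⟩
    have := hA.card_cliquesOver_of_forall_numComp hconn hG h
    omega
  · rintro ⟨hcard, hone⟩ S hS
    lift S to Finset V using S.toFinite
    rw [Set.ncard_coe_finset]
    refine hS.numComp_eq hconn hG (fun A hA => ?_) hone
    have := hcard _ A ⟨hA, rfl⟩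
    omega
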